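/- **Theorem 1.9 (Duality theorem).** Let $n\in\mathbb N$. A polynomial $f\in\mathbb C[z_1,\dots,z_n]$ is *stable* if $f(z_1,\dots,z_n)\neq 0$ whenever $\operatorname{Im} z_j>0$ for all $1\le j\le n$, and *real stable* if moreover all its coefficients are real. Let $\mathcal H_n(\mathbb C)$ and $\mathcal H_n(\mathbb R)$ denote the sets of stable and of real stable polynomials. Let $\mathcal A_n[\mathbb C]$ be the Weyl algebra of finite order linear differential operators with polynomial coefficients on $\mathbb C[z_1,\dots,z_n]$. Each $T\in\mathcal A_n[\mathbb C]$ has a unique representation $T=\sum_{\alpha,\beta\in\mathbb N^n}a_{\alpha\beta}z^\alpha\partial^\beta$ with $a_{\alpha\beta}\in\mathbb C$, only finitely many nonzero, and its Fischer–Fock adjoint is $$T^*=\sum_{\alpha,\beta\in\mathbb N^n}\overline{a_{\beta\alpha}}\,z^\alpha\partial^\beta\in\mathcal A_n[\mathbb C].$$ Let $\mathcal A_n[\mathbb R]$ be the set of those $T\in\mathcal A_n[\mathbb C]$ for which all $a_{\alpha\beta}$ are real. Let $\mathcal A_n(\mathbb C)$ be the set of nonzero $T\in\mathcal A_n[\mathbb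 C]$ with $T(\mathcal H_n(\mathbb C))\subseteq\mathcal H_n(\mathbb C)\cup\{0\}$ (the stability preservers), and $\mathcal A_n(\mathbb R)$ the set of nonzero $T\in\mathcal A_n[\mathbb R]$ with $T(\mathcal H_n(\mathbb R))\subseteq\mathcal H_n(\mathbb R)\cup\{0\}$ (the real stability preservers). Let $T\in\mathcal A_n[\mathbb C]$. Then $T\in\mathcal A_n(\mathbb C)$ if and only if $T^*\in\mathcal A_n(\mathbb C)$. Similarly, if $T\in\mathcal A_n[\mathbb R]$, then $T\in\mathcal A_n(\mathbb R)$ if and only if $T^*\in\mathcal A_n(\mathbb R)$. -/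

import Mathlib

/-- A polynomial `f ∈ ℂ[z_1, …, z_n]` is stable if it has no zero all of whose coordinates have
positive imaginary part. -/
def IsStable {n : ℕ} (f : MvPolynomial (Fin n) ℂ) : Prop :=
  ∀ z : Fin n → ℂ, (∀ i, 0 < (z i).im) → MvPolynomial.eval z f ≠ 0

/-- A polynomial is real stable if it is stable and all its coefficients are real. -/
def IsRealStable {n : ℕ} (f : MvPolynomial (Fin n) ℂ) : Prop :=
  IsStable f ∧ ∀ m : Fin n →₀ ℕ, (MvPolynomial.coeff m f).im = 0

/-- The operator `∂_i = ∂/∂z_i` on `ℂ[z_1, …, z_n]`. -/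
noncomputable def partialOp {n : ℕ} (i : Fin n) : Module.End ℂ (MvPolynomial (Fin n) ℂ) :=
  (MvPolynomial.pderiv i).toLinearMap

/-- The operator of multiplication by a polynomial `p`. -/
noncomputable def mulOp {n : ℕ} (p : MvPolynomial (Fin n) ℂ) :
    Module.End ℂ (MvPolynomial (Fin n) ℂ) :=
  LinearMap.mulLeft ℂ p

/-- The Weyl algebra `A_n[ℂ]`: the algebra of operators on `ℂ[z_1, …, z_n]` generated by the
multiplications by the variables and the partial derivatives. -/
noncomputable def weylAlgebra (n : ℕ) : Subalgebra ℂ (Module.End ℂ (MvPolynomial (Fin n) ℂ)) :=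
  Algebra.adjoin ℂ
    (Set.range (fun i : Fin n => mulOp (MvPolynomial.X i)) ∪
      Set.range (fun i : Fin n => partialOp i))

theorem partialOp_monomial {n : ℕ} (i : Fin n) (γ : Fin n →₀ ℕ) (a : ℂ) :
    partialOp i (MvPolynomial.monomial γ a) =
      MvPolynomial.monomial (γ - Finsupp.single i 1) (a * γ i) :=
  MvPolynomial.pderiv_monomial

theorem partialOp_pow_monomial {n : ℕ} (i : Fin n) (k : ℕ) (γ : Fin n →₀ ℕ) (a : ℂ) :
    (partialOp i ^ k) (MvPolynomial.monomial γ a) =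
      MvPolynomial.monomial (γ - Finsupp.single i k) (a * ((γ i).descFactorial k : ℕ)) := by
  induction k with
  | zero => simp
  | succ k ih =>
    rw [pow_succ', Module.End.mul_apply, ih, partialOp_monomial, tsub_tsub, ← Finsupp.single_add]
    congr 1
    simp only [Finsupp.coe_tsub, Pi.sub_apply, Finsupp.single_eq_same, Nat.descFactorial_succ]
    push_cast
    ring

theorem partialOp_commute {n : ℕ} (i j : Fin n) : Commute (partialOp i) (partialOp j) := by
  refine MvPolynomial.linearMap_ext fun γ => LinearMap.ext fun a => ?_
  simp only [LinearMap.comp_apply, Module.End.mul_apply, partialOp_monomial]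
  by_cases h : i = j
  · rw [h]
  · have h' : j ≠ i := fun e => h e.symm
    rw [tsub_right_comm]
    congr 1
    simp [h, h']
    ring

theorem partialOp_pairwise {n : ℕ} (β : Fin n →₀ ℕ) (s : Finset (Fin n)) :
    (s : Set (Fin n)).Pairwise (Function.onFun Commute fun i => partialOp i ^ β i) :=
  fun i _ j _ _ => (partialOp_commute i j).pow_pow _ _

/-- The operator `∂^β = ∂_1^{β_1} ⋯ ∂_n^{β_n}`. -/
noncomputable def partialPow {n : ℕ} (β : Fin n →₀ ℕ) :
    Module.End ℂ (MvPolynomial (Fin n) ℂ) :=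
  Finset.univ.noncommProd (fun i => partialOp i ^ β i) (partialOp_pairwise β Finset.univ)

theorem partialPow_monomial {n : ℕ} (β γ : Fin n →₀ ℕ) (a : ℂ) :
    partialPow β (MvPolynomial.monomial γ a) =
      MvPolynomial.monomial (γ - β) (a * (∏ i, (γ i).descFactorial (β i) : ℕ)) := by
  have key : ∀ s : Finset (Fin n),
      s.noncommProd (fun i => partialOp i ^ β i) (partialOp_pairwise β s)
        (MvPolynomial.monomial γ a) =
      MvPolynomial.monomial (γ - ∑ i ∈ s, Finsupp.single i (β i))
        (a * (∏ i ∈ s, (γ i).descFactorial (β i) : ℕ)) := by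
    intro s
    induction s using Finset.induction_on with
    | empty => simp
    | insert i s hi ih =>
      rw [Finset.noncommProd_insert_of_notMem _ _ _ _ hi, Module.End.mul_apply, ih,
        partialOp_pow_monomial, tsub_tsub, Finset.sum_insert hi, Finset.prod_insert hi,
        add_comm (Finsupp.single i (β i))]
      congr 1
      have h0 : (∑ j ∈ s, Finsupp.single j (β j)) i = 0 := by
        rw [Finsupp.finsetSum_apply]
        refine Finset.sum_eq_zero fun j hj => ?_
        rw [Finsupp.single_apply, if_neg]
        rintro rfl
        exact hi hj
      rw [Finsupp.tsub_apply, h0, tsub_zero]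
      push_cast
      ring
  have h := key Finset.univ
  rw [Finsupp.univ_sum_single] at h
  exact h

/-- Finite families of coefficients `(a_{αβ})`, indexed by pairs of multi-indices. -/
abbrev WeylCoeffs (n : ℕ) : Type := ((Fin n →₀ ℕ) × (Fin n →₀ ℕ)) →₀ ℂ

/-- The operator `z^α ∂^β`. -/
noncomputable def monomialOp {n : ℕ} (α β : Fin n →₀ ℕ) :
    Module.End ℂ (MvPolynomial (Fin n) ℂ) :=
  mulOp (MvPolynomial.monomial α 1) * partialPow β

/-- The operator `∑_{α, β} a_{αβ} z^α ∂^β` attached to a finite family of coefficients. -/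
noncomputable def normalForm (n : ℕ) :
    WeylCoeffs n →ₗ[ℂ] Module.End ℂ (MvPolynomial (Fin n) ℂ) :=
  Finsupp.linearCombination ℂ (fun p => monomialOp p.1 p.2)

theorem monomialOp_monomial {n : ℕ} (α β γ : Fin n →₀ ℕ) (a : ℂ) :
    monomialOp α β (MvPolynomial.monomial γ a) =
      MvPolynomial.monomial (α + (γ - β)) (a * (∏ i, (γ i).descFactorial (β i) : ℕ)) := by
  simp [monomialOp, mulOp, partialPow_monomial, MvPolynomial.monomial_mul]

theorem normalForm_injective (n : ℕ) : Function.Injective (normalForm n) := by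
  rw [injective_iff_map_eq_zero]
  intro c hc
  by_contra hne
  obtain ⟨p, hp, hmin⟩ := Finset.exists_min_image c.support (fun p => Finsupp.degree p.2)
    (Finsupp.support_nonempty_iff.2 hne)
  have h1 := congrArg (MvPolynomial.coeff p.1)
    (LinearMap.congr_fun hc (MvPolynomial.monomial p.2 1))
  rw [normalForm, Finsupp.linearCombination_apply, Finsupp.sum, LinearMap.sum_apply,
    MvPolynomial.coeff_sum, Finset.sum_eq_single_of_mem p hp] at h1
  · simp only [LinearMap.smul_apply, monomialOp_monomial, tsub_self, add_zero,
      MvPolynomial.coeff_smul, MvPolynomial.coeff_monomial, if_true, Nat.descFactorial_self,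
      LinearMap.zero_apply, MvPolynomial.coeff_zero, smul_eq_mul, one_mul] at h1
    rcases mul_eq_zero.1 h1 with h | h
    · exact Finsupp.mem_support_iff.1 hp h
    · rw [Nat.cast_eq_zero, Finset.prod_eq_zero_iff] at h
      obtain ⟨i, -, hi⟩ := h
      exact Nat.factorial_ne_zero _ hi
  · intro q hq hqp
    rw [LinearMap.smul_apply, monomialOp_monomial, MvPolynomial.coeff_smul,
      MvPolynomial.coeff_monomial]
    by_cases hle : q.2 ≤ p.2
    · have h2 : q.2 = p.2 := by
        have hd := hmin q hq
        obtain ⟨d, hd'⟩ := exists_add_of_le hle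
        rw [hd', map_add] at hd
        have : Finsupp.degree d = 0 := by omega
        rw [Finsupp.degree_eq_zero_iff] at this
        rw [hd', this, add_zero]
      rw [if_neg, smul_zero]
      rw [h2, tsub_self, add_zero]
      exact fun h => hqp (Prod.ext h h2)
    · have : ∃ i, p.2 i < q.2 i := by
        by_contra! h
        exact hle h
      obtain ⟨i, hi⟩ := this
      rw [Finset.prod_eq_zero (Finset.mem_univ i) (Nat.descFactorial_of_lt hi)]
      simp

theorem mulOp_X_mul_monomialOp {n : ℕ} (i : Fin n) (α β : Fin n →₀ ℕ) :
    mulOp (MvPolynomial.X i) * monomialOp α β = monomialOp (Finsupp.single i 1 + α) β := by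
  refine MvPolynomial.linearMap_ext fun γ => LinearMap.ext fun a => ?_
  simp [Module.End.mul_apply, monomialOp_monomial, mulOp, MvPolynomial.X,
    MvPolynomial.monomial_mul, add_assoc]

theorem partialOp_mul_monomialOp {n : ℕ} (i : Fin n) (α β : Fin n →₀ ℕ) :
    partialOp i * monomialOp α β =
      monomialOp α (Finsupp.single i 1 + β) +
        (α i : ℂ) • monomialOp (α - Finsupp.single i 1) β := by
  have h : partialPow (Finsupp.single i 1 + β) = partialOp i * partialPow β := by
    refine MvPolynomial.linearMap_ext fun γ => LinearMap.ext fun a => ?_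
    simp only [LinearMap.comp_apply, Module.End.mul_apply, partialPow_monomial, partialOp_monomial]
    rw [add_comm, ← tsub_tsub, mul_assoc]
    congr 2
    rw [← Finset.mul_prod_erase _ _ (Finset.mem_univ i),
      ← Finset.mul_prod_erase _ _ (Finset.mem_univ i)]
    have : ∀ j ∈ Finset.univ.erase i, (γ j).descFactorial ((β + Finsupp.single i 1 : Fin n →₀ ℕ) j) =
        (γ j).descFactorial (β j) := by
      intro j hj
      rw [Finsupp.add_apply, Finsupp.single_apply, if_neg (Finset.ne_of_mem_erase hj).symm,
        add_zero]
    rw [Finset.prod_congr rfl this]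
    simp [Nat.descFactorial_succ]
    ring
  refine LinearMap.ext fun f => ?_
  simp only [monomialOp, h, Module.End.mul_apply, LinearMap.add_apply, LinearMap.smul_apply]
  simp only [mulOp, partialOp, LinearMap.mulLeft_apply, Derivation.coeFn_coe, Derivation.leibniz,
    MvPolynomial.pderiv_monomial, smul_eq_mul, one_mul]
  rw [← smul_mul_assoc, MvPolynomial.smul_monomial, smul_eq_mul, mul_one]
  ring

theorem mulOp_X_mem {n : ℕ} (i : Fin n) : mulOp (MvPolynomial.X i) ∈ weylAlgebra n :=
  Algebra.subset_adjoin (Or.inl ⟨i, rfl⟩)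

theorem partialOp_mem {n : ℕ} (i : Fin n) : partialOp i ∈ weylAlgebra n :=
  Algebra.subset_adjoin (Or.inr ⟨i, rfl⟩)

theorem monomialOp_mem {n : ℕ} (α β : Fin n →₀ ℕ) : monomialOp α β ∈ weylAlgebra n := by
  refine mul_mem ?_ ?_
  · induction α using Finsupp.induction_linear with
    | zero =>
      have : mulOp (MvPolynomial.monomial (0 : Fin n →₀ ℕ) (1 : ℂ)) = 1 := by
        refine LinearMap.ext fun f => ?_
        simp [mulOp]
      rw [this]
      exact one_mem _
    | add f g hf hg =>
      have : mulOp (MvPolynomial.monomial (f + g) (1 : ℂ)) =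
          mulOp (MvPolynomial.monomial f 1) * mulOp (MvPolynomial.monomial g 1) := by
        refine LinearMap.ext fun q => ?_
        simp only [mulOp, LinearMap.mulLeft_apply, Module.End.mul_apply, ← mul_assoc,
          MvPolynomial.monomial_mul, mul_one]
      rw [this]
      exact mul_mem hf hg
    | single i k =>
      have : mulOp (MvPolynomial.monomial (Finsupp.single i k) (1 : ℂ)) =
          mulOp (MvPolynomial.X i) ^ k := by
        rw [mulOp, mulOp, LinearMap.pow_mulLeft, MvPolynomial.X_pow_eq_monomial]
      rw [this]
      exact Subalgebra.pow_mem _ (mulOp_X_mem i) k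
  · refine Submonoid.noncommProd_mem (weylAlgebra n).toSubmonoid _ _ _ fun i _ => ?_
    exact Subalgebra.pow_mem _ (partialOp_mem i) _

/-- The Weyl algebra consists exactly of the operators `∑ a_{αβ} z^α ∂^β`. -/
theorem range_normalForm (n : ℕ) :
    LinearMap.range (normalForm n) = Subalgebra.toSubmodule (weylAlgebra n) := by
  rw [normalForm, Finsupp.range_linearCombination]
  apply le_antisymm
  · rw [Submodule.span_le]
    rintro _ ⟨p, rfl⟩
    exact monomialOp_mem p.1 p.2
  · set S := Submodule.span ℂ
      (Set.range fun p : (Fin n →₀ ℕ) × (Fin n →₀ ℕ) => monomialOp p.1 p.2) with hS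
    have hmem : ∀ α β : Fin n →₀ ℕ, monomialOp α β ∈ S := fun α β =>
      Submodule.subset_span ⟨(α, β), rfl⟩
    have hstep : ∀ x ∈ weylAlgebra n, ∀ y ∈ S, x * y ∈ S := by
      intro x hx
      induction hx using Algebra.adjoin_induction with
      | mem x hx =>
        intro y hy
        induction hy using Submodule.span_induction with
        | mem y hy =>
          obtain ⟨⟨α, β⟩, rfl⟩ := hy
          rcases hx with ⟨i, rfl⟩ | ⟨i, rfl⟩
          · simpa only [mulOp_X_mul_monomialOp] using hmem _ _
          · simpa only [partialOp_mul_monomialOp] using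
              S.add_mem (hmem _ _) (S.smul_mem _ (hmem _ _))
        | zero => simp
        | add u v _ _ hu hv => rw [mul_add]; exact S.add_mem hu hv
        | smul r u _ hu => rw [mul_smul_comm]; exact S.smul_mem _ hu
      | algebraMap r =>
        intro y hy
        rw [← Algebra.smul_def]
        exact S.smul_mem _ hy
      | add u v _ _ hu hv => intro y hy; rw [add_mul]; exact S.add_mem (hu y hy) (hv y hy)
      | mul u v _ _ hu hv => intro y hy; rw [mul_assoc]; exact hu _ (hv y hy)
    intro x hx
    have h1 : (1 : Module.End ℂ (MvPolynomial (Fin n) ℂ)) = monomialOp 0 0 := by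
      refine MvPolynomial.linearMap_ext fun γ => LinearMap.ext fun a => ?_
      simp [monomialOp_monomial]
    rw [← mul_one x, h1]
    exact hstep x hx _ (hmem 0 0)

/-- Every coefficient family gives an element of the Weyl algebra, bijectively. -/
noncomputable def weylEquiv (n : ℕ) : WeylCoeffs n ≃ₗ[ℂ] weylAlgebra n :=
  (LinearEquiv.ofInjective (normalForm n) (normalForm_injective n)).trans
    (LinearEquiv.ofEq _ _ (range_normalForm n))

theorem coe_weylEquiv {n : ℕ} (a : WeylCoeffs n) :
    (weylEquiv n a : Module.End ℂ (MvPolynomial (Fin n) ℂ)) =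
      a.sum fun p c => c • monomialOp p.1 p.2 :=
  rfl

/-- The coefficients `a_{αβ}` in the unique expansion `T = ∑ a_{αβ} z^α ∂^β`. -/
noncomputable def weylCoeff {n : ℕ} (T : weylAlgebra n) (α β : Fin n →₀ ℕ) : ℂ :=
  (weylEquiv n).symm T (α, β)

/-- The coefficient family `(α, β) ↦ conj a_{βα}`. -/
noncomputable def adjointCoeffs {n : ℕ} (a : WeylCoeffs n) : WeylCoeffs n :=
  (a.mapRange (starRingEnd ℂ) (map_zero _)).equivMapDomain (Equiv.prodComm _ _)

/-- The Fischer–Fock adjoint `T* = ∑ conj(a_{βα}) z^α ∂^β` of `T = ∑ a_{αβ} z^α ∂^β`. -/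
noncomputable def weylAdjoint {n : ℕ} (T : weylAlgebra n) : weylAlgebra n :=
  weylEquiv n (adjointCoeffs ((weylEquiv n).symm T))

theorem weylCoeff_weylAdjoint {n : ℕ} (T : weylAlgebra n) (α β : Fin n →₀ ℕ) :
    weylCoeff (weylAdjoint T) α β = starRingEnd ℂ (weylCoeff T β α) := by
  simp [weylCoeff, weylAdjoint, adjointCoeffs, Finsupp.equivMapDomain_apply]

/-- `A_n[ℝ]`: the operators in the Weyl algebra all of whose coefficients `a_{αβ}` are real. -/
def realWeyl (n : ℕ) : Set (weylAlgebra n) :=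
  {T | ∀ α β : Fin n →₀ ℕ, (weylCoeff T α β).im = 0}

/-- `A_n(ℂ)`: the nonzero operators in the Weyl algebra that map every stable polynomial to a stable
polynomial or to zero. -/
def stabilityPreservers (n : ℕ) : Set (weylAlgebra n) :=
  {T | T ≠ 0 ∧ ∀ f : MvPolynomial (Fin n) ℂ, IsStable f → IsStable (T.1 f) ∨ T.1 f = 0}

/-- `A_n(ℝ)`: the nonzero operators in `A_n[ℝ]` that map every real stable polynomial to a real
stable polynomial or to zero. -/
def realStabilityPreservers (n : ℕ) : Set (weylAlgebra n) :=
  {T | T ∈ realWeyl n ∧ T ≠ 0 ∧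
    ∀ f : MvPolynomial (Fin n) ℂ, IsRealStable f → IsRealStable (T.1 f) ∨ T.1 f = 0}

/-!
A nonzero operator `T = ∑ a_{αβ} z^α ∂^β` preserves stability (or, if its coefficients are real, real
stability) exactly when the polynomial `∑ a_{αβ} z^α (-w)^β` in `2n` variables, `signedSymbol`, is
stable. Passing to the adjoint composes this polynomial with the symmetry
`(z, w) ↦ (-conj w, -conj z)` of the product of upper half planes, up to conjugation of its value,
so the duality follows.

If the symbol is stable and `f` is stable, then so is `F(z, -u) f(v)`, where `F` is the symbol
without signs, and `T f` arises from it by replacing each `u_i` by `-∂_{v_i}` and setting `v = z`.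
This replacement is done in steps that lower the degree in `u_i` by one, each of which is a polar
derivative with its pole replaced by `-∂_{v_i}` (`UpperStable.contract`). By Laguerre's theorem,
`Polynomial.polar_ne_zero`, each step preserves stability.

Conversely, let `T` preserve stability or real stability, and let `w` lie in the product of upper
half planes. By a Hermite–Kakeya–Obreschkoff argument (`isOneSided_of_real_pencil`) the image of
`∏ (z_i + w_i)^N` is zero or has no zeros on one of the products of upper or of lower half planes.
For large `N` it is not zero (`PreservesStability.normalForm_polyShift_ne_zero`), and it vanishes at
`z = -w`, so it is stable. For `w_i = -N / v_i` and `N → ∞` these images, divided by suitable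
nonvanishing factors, tend to the value of the symbol at `(z, -v)`, and Hurwitz's theorem
(`UpperStable.of_tendsto`) applies.
-/

open Filter Topology

/-! ### Univariate polynomials without zeros in the upper half plane -/

/-- A Harnack inequality: the values of a polynomial of bounded degree without zeros near `0` are
controlled by its value at `0`. Unlike a statement on roots, it passes to pointwise limits. -/
theorem Polynomial.norm_eval_one_le {q : Polynomial ℂ} {D : ℕ} (hD : q.natDegree ≤ D) {ρ : ℝ}
    (hρ : 0 < ρ) (hq : ∀ t : ℂ, ‖t‖ < ρ → q.eval t ≠ 0) :
    ‖q.eval 1‖ ≤ ‖q.eval 0‖ * (1 + 1 / ρ) ^ D := by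
  have hs := IsAlgClosed.splits q
  have hq0 : q ≠ 0 := by
    rintro rfl
    exact hq 0 (by simpa using hρ) (by simp)
  have key : ∀ S : Multiset ℂ, (∀ r ∈ S, ρ ≤ ‖r‖) →
      ‖(S.map fun r => 1 - r).prod‖ ≤ ‖(S.map fun r => 0 - r).prod‖ * (1 + 1 / ρ) ^ S.card := by
    intro S
    induction S using Multiset.induction_on with
    | empty => simp
    | cons r S ih =>
      intro h
      have h1 := ih fun r hr => h r (Multiset.mem_cons_of_mem hr)
      have h2 := h r (Multiset.mem_cons_self r S)
      have h3 : ‖1 - r‖ ≤ ‖0 - r‖ * (1 + 1 / ρ) := by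
        have : 1 ≤ ‖r‖ * (1 / ρ) := by
          rw [mul_one_div, le_div_iff₀ hρ]
          linarith
        calc ‖1 - r‖ ≤ ‖(1 : ℂ)‖ + ‖r‖ := norm_sub_le _ _
          _ ≤ ‖0 - r‖ * (1 + 1 / ρ) := by
            rw [zero_sub, norm_neg, norm_one]
            linarith
      simp only [Multiset.map_cons, Multiset.prod_cons, norm_mul, Multiset.card_cons, pow_succ]
      calc _ ≤ (‖0 - r‖ * (1 + 1 / ρ)) *
            (‖(S.map fun r => 0 - r).prod‖ * (1 + 1 / ρ) ^ S.card) :=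
            mul_le_mul h3 h1 (norm_nonneg _) (by positivity)
        _ = _ := by ring
  have hroots : ∀ r ∈ q.roots, ρ ≤ ‖r‖ := fun r hr => by
    by_contra! h
    exact hq r h (Polynomial.isRoot_of_mem_roots hr)
  rw [hs.eval_eq_prod_roots 1, hs.eval_eq_prod_roots 0, norm_mul, norm_mul, mul_assoc]
  refine mul_le_mul_of_nonneg_left ((key _ hroots).trans ?_) (norm_nonneg _)
  refine mul_le_mul_of_nonneg_left ?_ (norm_nonneg _)
  exact pow_le_pow_right₀ (by simp [hρ.le]) ((Polynomial.card_roots' q).trans hD)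

/-- The map `r ↦ 1 / (u - r)` takes the closed lower half plane into a disc through the origin. -/
theorem norm_inv_sub_add_le_iff {u r : ℂ} (hu : 0 < u.im) (hur : u ≠ r) :
    ‖1 / (u - r) + Complex.I / (2 * u.im)‖ ≤ 1 / (2 * u.im) ↔ r.im ≤ 0 := by
  have hv : u - r ≠ 0 := sub_ne_zero.2 hur
  have hy : (u.im : ℂ) ≠ 0 := by exact_mod_cast hu.ne'
  have h1 : 1 / (u - r) + Complex.I / (2 * u.im) =
      (2 * u.im + Complex.I * (u - r)) / ((u - r) * (2 * u.im)) := by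
    field_simp
  have h2 : ‖(u - r) * (2 * u.im : ℂ)‖ = ‖u - r‖ * (2 * u.im) := by
    simp [abs_of_pos hu]
  have hn : 0 < ‖u - r‖ := norm_pos_iff.2 hv
  rw [h1, norm_div, h2, div_le_div_iff₀ (by positivity) (by positivity), one_mul,
    mul_le_mul_iff_of_pos_right (by positivity), ← sq_le_sq₀ (norm_nonneg _) (norm_nonneg _),
    ← Complex.normSq_eq_norm_sq, ← Complex.normSq_eq_norm_sq, Complex.normSq_apply,
    Complex.normSq_apply]
  simp only [Complex.add_re, Complex.add_im, Complex.mul_re, Complex.mul_im, Complex.sub_re,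
    Complex.sub_im, Complex.I_re, Complex.I_im, Complex.ofReal_re, Complex.ofReal_im,
    Complex.re_ofNat, Complex.im_ofNat]
  constructor <;> intro h <;> nlinarith

/-- Laguerre's theorem on polar derivatives, for the upper half plane. The points `1 / (u - r)` with
`r` outside the half plane form a disc minus the origin, and `p'(u) / (d p(u))` is a convex
combination of `0` and such points. -/
theorem Polynomial.polar_ne_zero {p : Polynomial ℂ} (hp : ∀ u : ℂ, 0 < u.im → p.eval u ≠ 0) {d : ℕ}
    (hd : 0 < d) (hpd : p.natDegree ≤ d) {u s : ℂ} (hu : 0 < u.im) (hs : 0 < s.im) :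
    d * p.eval u + (s - u) * p.derivative.eval u ≠ 0 := by
  intro h0
  have hpu := hp u hu
  have hdC : (d : ℂ) ≠ 0 := by exact_mod_cast hd.ne'
  have hus : u ≠ s := by
    rintro rfl
    simp [hdC, hpu] at h0
  have hus' : u - s ≠ 0 := sub_ne_zero.2 hus
  have hx := (IsAlgClosed.splits p).eval_derivative_div_eval_of_ne_zero hpu
  set c : ℂ := Complex.I / (2 * u.im) with hc
  set R : ℝ := 1 / (2 * u.im) with hR
  have hcR : ‖c‖ = R := by
    simp [hc, hR, abs_of_pos hu]
  have key : ∀ S : Multiset ℂ, (∀ r ∈ S, r.im ≤ 0) →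
      ‖(S.map fun r => 1 / (u - r)).sum + S.card * c‖ ≤ S.card * R := by
    intro S
    induction S using Multiset.induction_on with
    | empty => simp
    | cons r S ih =>
      intro h
      have h1 := ih fun r hr => h r (Multiset.mem_cons_of_mem hr)
      have hr := h r (Multiset.mem_cons_self r S)
      have h2 := (norm_inv_sub_add_le_iff hu (by rintro rfl; linarith)).2 hr
      simp only [Multiset.map_cons, Multiset.sum_cons, Multiset.card_cons]
      push_cast
      calc _ = ‖(1 / (u - r) + c) + ((S.map fun r => 1 / (u - r)).sum + S.card * c)‖ := by
            congr 1
            ring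
        _ ≤ R + S.card * R := (norm_add_le _ _).trans (add_le_add h2 h1)
        _ = _ := by ring
  have h1 := key p.roots fun r hr => by
    by_contra! h
    exact hp r h (Polynomial.isRoot_of_mem_roots hr)
  rw [← hx] at h1
  have hcard : p.roots.card ≤ d := (Polynomial.card_roots' p).trans hpd
  have hxv : p.derivative.eval u / p.eval u = d * (1 / (u - s)) := by
    field_simp
    linear_combination -h0
  have h2 : ‖(d : ℂ) * (1 / (u - s) + c)‖ ≤ d * R := by
    calc _ = ‖(p.derivative.eval u / p.eval u + p.roots.card * c) +
          ((d - p.roots.card : ℕ) : ℂ) * c‖ := by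
          rw [hxv, Nat.cast_sub hcard]
          congr 1
          ring
      _ ≤ p.roots.card * R + ((d - p.roots.card : ℕ) : ℝ) * R := by
          refine (norm_add_le _ _).trans (add_le_add h1 ?_)
          rw [norm_mul, hcR, Complex.norm_natCast]
      _ = d * R := by
          rw [Nat.cast_sub hcard]
          ring
  rw [norm_mul, Complex.norm_natCast] at h2
  have h3 := (norm_inv_sub_add_le_iff hu hus).1
    (le_of_mul_le_mul_left h2 (by exact_mod_cast hd))
  linarith

theorem Polynomial.im_derivative_div_nonpos {p : Polynomial ℂ}
    (hp : ∀ u : ℂ, 0 < u.im → p.eval u ≠ 0) {u : ℂ} (hu : 0 < u.im) :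
    (p.derivative.eval u / p.eval u).im ≤ 0 := by
  by_contra! h
  set x := p.derivative.eval u / p.eval u with hx
  have hx0 : x ≠ 0 := by
    intro h0
    simp [h0] at h
  set d := p.natDegree + 1 with hd
  -- If the claim fails, the polar derivative vanishes for this pole `s` in the half plane.
  have hs : 0 < (u - d / x).im := by
    have h1 : ((d : ℂ) / x).im = -(d * x.im / Complex.normSq x) := by
      simp [Complex.div_im]
    rw [Complex.sub_im, h1]
    have : 0 < d * x.im / Complex.normSq x := by
      have := Complex.normSq_pos.2 hx0
      have : (0 : ℝ) < d := by positivity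
      positivity
    linarith
  refine Polynomial.polar_ne_zero hp (Nat.succ_pos _) (Nat.le_succ _) hu hs ?_
  have h2 : p.derivative.eval u = x * p.eval u := by
    rw [hx, div_mul_cancel₀ _ (hp u hu)]
  rw [h2]
  field_simp
  simp only [hd, Nat.succ_eq_add_one]
  ring

theorem Polynomial.norm_eval_neg_I_le {p : Polynomial ℂ}
    (hp : ∀ u : ℂ, 0 < u.im → p.eval u ≠ 0) :
    ‖p.eval (-Complex.I)‖ ≤ ‖p.eval Complex.I‖ := by
  have hs := IsAlgClosed.splits p
  have key : ∀ S : Multiset ℂ, (∀ r ∈ S, r.im ≤ 0) →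
      ‖(S.map fun r => -Complex.I - r).prod‖ ≤ ‖(S.map fun r => Complex.I - r).prod‖ := by
    intro S
    induction S using Multiset.induction_on with
    | empty => simp
    | cons r S ih =>
      intro h
      have h1 := ih fun r hr => h r (Multiset.mem_cons_of_mem hr)
      have h2 := h r (Multiset.mem_cons_self r S)
      simp only [Multiset.map_cons, Multiset.prod_cons, norm_mul]
      refine mul_le_mul ?_ h1 (norm_nonneg _) (norm_nonneg _)
      rw [← sq_le_sq₀ (norm_nonneg _) (norm_nonneg _), ← Complex.normSq_eq_norm_sq,
        ← Complex.normSq_eq_norm_sq, Complex.normSq_apply, Complex.normSq_apply]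
      simp only [Complex.sub_re, Complex.sub_im, Complex.neg_re, Complex.neg_im, Complex.I_re,
        Complex.I_im]
      nlinarith
  rw [hs.eval_eq_prod_roots, hs.eval_eq_prod_roots, norm_mul, norm_mul]
  refine mul_le_mul_of_nonneg_left (key _ fun r hr => ?_) (norm_nonneg _)
  by_contra! h
  exact hp r h (Polynomial.isRoot_of_mem_roots hr)

/-! ### Stable polynomials in several variables -/

/-- Stability for an arbitrary index type of variables; for `Fin n` this is `IsStable`. -/
def UpperStable {σ : Type*} (f : MvPolynomial σ ℂ) : Prop :=
  ∀ z : σ → ℂ, (∀ i, 0 < (z i).im) → MvPolynomial.eval z f ≠ 0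

theorem eval_aeval_polynomial {σ : Type*} (f : σ → Polynomial ℂ) (P : MvPolynomial σ ℂ) (t : ℂ) :
    (MvPolynomial.aeval f P).eval t = MvPolynomial.eval (fun i => (f i).eval t) P := by
  induction P using MvPolynomial.induction_on with
  | C c => simp
  | add p q hp hq => simp [hp, hq]
  | mul_X p i hp => simp [hp]

theorem exists_line_polynomial {σ : Type*} (z₀ z : σ → ℂ) (P : MvPolynomial σ ℂ) :
    ∃ q : Polynomial ℂ, (∀ t, q.eval t = MvPolynomial.eval (fun i => z₀ i + t * (z i - z₀ i)) P) ∧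
      q.natDegree ≤ P.totalDegree := by
  refine ⟨MvPolynomial.aeval
    (fun i => Polynomial.C (z₀ i) + Polynomial.X * Polynomial.C (z i - z₀ i)) P, fun t => ?_, ?_⟩
  · rw [eval_aeval_polynomial]
    simp
  · rw [← mul_one P.totalDegree]
    refine MvPolynomial.aeval_natDegree_le P le_rfl _ fun i => ?_
    exact Polynomial.natDegree_add_le_of_degree_le (by simp)
      ((Polynomial.natDegree_mul_C_le _ _).trans Polynomial.natDegree_X_le)

namespace UpperStable

variable {σ : Type*}

theorem mul {f g : MvPolynomial σ ℂ} (hf : UpperStable f) (hg : UpperStable g) :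
    UpperStable (f * g) := fun z hz => by
  rw [map_mul]
  exact mul_ne_zero (hf z hz) (hg z hz)

theorem of_smul {f : MvPolynomial σ ℂ} {c : ℂ} (h : UpperStable (c • f)) :
    UpperStable f := fun z hz h0 => h z hz (by rw [MvPolynomial.smul_eval, h0, mul_zero])

/-- Hurwitz's theorem for polynomials of bounded degree, with pointwise convergence. -/
theorem of_tendsto [Finite σ] {ι : Type*} {l : Filter ι} [l.NeBot] {P : ι → MvPolynomial σ ℂ}
    {Q : MvPolynomial σ ℂ} {D : ℕ} (hdeg : ∀ k, (P k).totalDegree ≤ D)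
    (hP : ∀ᶠ k in l, UpperStable (P k))
    (hlim : ∀ z, Tendsto (fun k => MvPolynomial.eval z (P k)) l (𝓝 (MvPolynomial.eval z Q))) :
    UpperStable Q ∨ Q = 0 := by
  by_contra! hcon
  obtain ⟨h1, h2⟩ := hcon
  simp only [UpperStable, not_forall, not_not] at h1
  obtain ⟨z₀, hz₀, hQ⟩ := h1
  refine h2 (MvPolynomial.funext fun z => ?_)
  rw [map_zero]
  -- The line through `z₀` and `z` stays in the domain for small values of the parameter.
  have hopen : ∀ᶠ t : ℂ in 𝓝 0, ∀ i, 0 < (z₀ i + t * (z i - z₀ i)).im := by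
    rw [eventually_all]
    intro i
    have hc : Continuous fun t : ℂ => (z₀ i + t * (z i - z₀ i)).im := by fun_prop
    exact hc.continuousAt.eventually (lt_mem_nhds (by simpa using hz₀ i))
  obtain ⟨ρ, hρ, hball⟩ := Metric.eventually_nhds_iff.1 hopen
  have hle : ∀ᶠ k in l, ‖MvPolynomial.eval z (P k)‖ ≤
      ‖MvPolynomial.eval z₀ (P k)‖ * (1 + 1 / ρ) ^ D := by
    filter_upwards [hP] with k hk
    obtain ⟨q, hqe, hqd⟩ := exists_line_polynomial z₀ z (P k)
    have := Polynomial.norm_eval_one_le (hqd.trans (hdeg k)) hρ fun t ht => by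
      rw [hqe]
      exact hk _ (hball (by simpa using ht))
    simpa [hqe] using this
  have hlim' := le_of_tendsto_of_tendsto (hlim z).norm ((hlim z₀).norm.mul_const _) hle
  rw [hQ] at hlim'
  simpa using hlim'

theorem of_pencil [Finite σ] {A B : MvPolynomial σ ℂ}
    (h : ∀ t : ℝ, 0 < t → UpperStable (A + (t : ℂ) • B)) : UpperStable A ∨ A = 0 := by
  refine of_tendsto (l := 𝓝[>] (0 : ℝ)) (P := fun t : ℝ => A + (t : ℂ) • B)
    (D := max A.totalDegree B.totalDegree) (fun t => ?_) ?_ fun z => ?_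
  · exact (MvPolynomial.totalDegree_add _ _).trans
      (max_le_max le_rfl (MvPolynomial.totalDegree_smul_le _ _))
  · filter_upwards [self_mem_nhdsWithin] with t ht using h t ht
  · have : Continuous fun t : ℝ => MvPolynomial.eval z (A + (t : ℂ) • B) := by
      simp only [map_add, MvPolynomial.smul_eval]
      fun_prop
    have := (this.tendsto 0).mono_left (nhdsWithin_le_nhds (s := Set.Ioi 0))
    simpa using this

end UpperStable

open Classical in
/-- The univariate polynomial obtained by fixing all variables except `a` at the values `z`. -/
noncomputable def sliceAt {σ : Type*} (z : σ → ℂ) (a : σ) (G : MvPolynomial σ ℂ) : Polynomial ℂ :=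
  MvPolynomial.aeval (Function.update (fun i => Polynomial.C (z i)) a Polynomial.X) G

open Classical in
theorem eval_sliceAt {σ : Type*} (z : σ → ℂ) (a : σ) (G : MvPolynomial σ ℂ) (t : ℂ) :
    (sliceAt z a G).eval t = MvPolynomial.eval (Function.update z a t) G := by
  rw [sliceAt, eval_aeval_polynomial]
  congr 2
  ext i
  by_cases h : i = a
  · subst h; simp
  · simp [h]

theorem eval_sliceAt_self {σ : Type*} (z : σ → ℂ) (a : σ) (G : MvPolynomial σ ℂ) :
    (sliceAt z a G).eval (z a) = MvPolynomial.eval z G := by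
  classical
  rw [eval_sliceAt, Function.update_eq_self]

theorem derivative_sliceAt {σ : Type*} (z : σ → ℂ) (a : σ) (G : MvPolynomial σ ℂ) :
    (sliceAt z a G).derivative = sliceAt z a (MvPolynomial.pderiv a G) := by
  classical
  induction G using MvPolynomial.induction_on with
  | C c => simp [sliceAt]
  | add p q hp hq =>
    simp only [sliceAt, map_add] at hp hq ⊢
    rw [hp, hq]
  | mul_X p i hp =>
    simp only [sliceAt, map_mul, MvPolynomial.aeval_X, Polynomial.derivative_mul,
      MvPolynomial.pderiv_mul, map_add] at hp ⊢
    rw [hp]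
    by_cases h : i = a
    · subst h; simp
    · simp [h, MvPolynomial.pderiv_X_of_ne h]

theorem natDegree_sliceAt_le {σ : Type*} (z : σ → ℂ) (a : σ) (G : MvPolynomial σ ℂ) :
    (sliceAt z a G).natDegree ≤ G.degreeOf a := by
  classical
  rw [sliceAt, MvPolynomial.aeval_def, MvPolynomial.eval₂_eq]
  refine Polynomial.natDegree_sum_le_of_forall_le _ _ fun m hm => ?_
  refine Polynomial.natDegree_C_mul_le _ _ |>.trans ?_
  refine (Polynomial.natDegree_prod_le _ _).trans ?_
  refine le_trans ?_ (MvPolynomial.monomial_le_degreeOf a hm)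
  calc _ ≤ ∑ i ∈ m.support, if i = a then m a else 0 := by
        refine Finset.sum_le_sum fun i _ => ?_
        by_cases h : i = a
        · subst h; simp
        · simp only [Function.update_of_ne h, if_neg h, ← Polynomial.C_pow,
            Polynomial.natDegree_C, le_refl]
    _ ≤ m a := by
        rw [Finset.sum_ite_eq']
        split_ifs <;> simp

namespace UpperStable

variable {σ : Type*} {G : MvPolynomial σ ℂ}

theorem sliceAt_ne_zero (hG : UpperStable G) {z : σ → ℂ} (hz : ∀ i, 0 < (z i).im) (a : σ) (u : ℂ)
    (hu : 0 < u.im) : (sliceAt z a G).eval u ≠ 0 := by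
  classical
  rw [eval_sliceAt]
  refine hG _ fun i => ?_
  by_cases h : i = a
  · subst h; simpa using hu
  · simpa [h] using hz i

theorem polar_ne_zero (hG : UpperStable G) {a : σ} {d : ℕ} (hd : 0 < d) (hGd : G.degreeOf a ≤ d)
    {z : σ → ℂ} (hz : ∀ i, 0 < (z i).im) {s : ℂ} (hs : 0 < s.im) :
    d * MvPolynomial.eval z G +
      (s - z a) * MvPolynomial.eval z (MvPolynomial.pderiv a G) ≠ 0 := by
  have := Polynomial.polar_ne_zero (hG.sliceAt_ne_zero hz a) hd
    ((natDegree_sliceAt_le z a G).trans hGd) (hz a) hs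
  rwa [derivative_sliceAt, eval_sliceAt_self, eval_sliceAt_self] at this

theorem im_pderiv_div_nonpos (hG : UpperStable G) (a : σ) {z : σ → ℂ} (hz : ∀ i, 0 < (z i).im) :
    (MvPolynomial.eval z (MvPolynomial.pderiv a G) / MvPolynomial.eval z G).im ≤ 0 := by
  have := Polynomial.im_derivative_div_nonpos (hG.sliceAt_ne_zero hz a) (hz a)
  rwa [derivative_sliceAt, eval_sliceAt_self, eval_sliceAt_self] at this

/-- The derivative is the limit of polar derivatives as the pole tends to infinity. -/
theorem pderiv [Finite σ] (hG : UpperStable G) (a : σ) :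
    UpperStable (MvPolynomial.pderiv a G) ∨ MvPolynomial.pderiv a G = 0 := by
  set d := G.degreeOf a + 1 with hd
  refine of_pencil (B := (-Complex.I) • ((d : ℂ) • G - MvPolynomial.X a * MvPolynomial.pderiv a G))
    fun t ht z hz h0 => ?_
  have htC : (t : ℂ) ≠ 0 := by exact_mod_cast ht.ne'
  refine hG.polar_ne_zero (d := d) (Nat.succ_pos _) (Nat.le_succ _) hz
    (s := Complex.I / t) ?_ ?_ (a := a)
  · rw [Complex.div_ofReal_im, Complex.I_im]
    positivity
  · simp only [map_add, MvPolynomial.smul_eval, map_sub, map_mul, MvPolynomial.eval_X] at h0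
    field_simp
    linear_combination Complex.I * h0 +
      t * (d * MvPolynomial.eval z G - z a * MvPolynomial.eval z (MvPolynomial.pderiv a G)) *
      Complex.I_sq

end UpperStable

/-! ### Replacing a variable by a derivative -/

/-- The operator `1 - (z_a + ∂_b) ∂_a / d`. It is a polar derivative in `z_a` with its pole replaced
by `-∂_b`. -/
noncomputable def contract {σ : Type*} (a b : σ) (d : ℕ) (G : MvPolynomial σ ℂ) :
    MvPolynomial σ ℂ :=
  G - (1 / d : ℂ) • (MvPolynomial.X a * MvPolynomial.pderiv a G +
    MvPolynomial.pderiv b (MvPolynomial.pderiv a G))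

/-- The Lieb–Sokal lemma in polar form. Where `∂_a G ≠ 0`, the quotient of `contract a b d G` by
`∂_a G / d` is a point of the closed upper half plane (by Laguerre) minus a logarithmic derivative,
which lies in the closed lower one; adding a multiple of `i ∂_a G` makes this strict. -/
theorem UpperStable.contract {σ : Type*} [Finite σ] {G : MvPolynomial σ ℂ} (hG : UpperStable G)
    {a b : σ} {d : ℕ} (hd : 0 < d) (hGd : G.degreeOf a ≤ d) :
    UpperStable (contract a b d G) ∨ _root_.contract a b d G = 0 := by
  rcases hG.pderiv a with hGa | hGa
  swap
  · left
    simpa [_root_.contract, hGa] using hG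
  refine UpperStable.of_pencil (B := Complex.I • MvPolynomial.pderiv a G) fun t ht z hz h0 => ?_
  have hdC : (d : ℂ) ≠ 0 := by exact_mod_cast hd.ne'
  have hdR : (0 : ℝ) < d := by exact_mod_cast hd
  have hb := hGa.im_pderiv_div_nonpos b hz
  set g := MvPolynomial.eval z G with hg
  set g' := MvPolynomial.eval z (MvPolynomial.pderiv a G) with hg'
  set g'' := MvPolynomial.eval z (MvPolynomial.pderiv b (MvPolynomial.pderiv a G)) with hg''
  have hg0 : g' ≠ 0 := hGa z hz
  have ha : 0 ≤ (d * g / g' - z a).im := by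
    by_contra! h
    refine hG.polar_ne_zero hd hGd hz (s := -(d * g / g' - z a)) (a := a) ?_ ?_
    · rw [Complex.neg_im]
      linarith
    · rw [← hg, ← hg']
      field_simp
      ring
  have h1 : (d * g / g' - z a) - g'' / g' + d * t * Complex.I = 0 := by
    simp only [_root_.contract, map_add, MvPolynomial.smul_eval, map_sub, map_mul,
      MvPolynomial.eval_X] at h0
    rw [← hg, ← hg', ← hg''] at h0
    field_simp at h0 ⊢
    linear_combination h0
  have h2 := congrArg Complex.im h1
  have h3 : ((d : ℂ) * t * Complex.I).im = d * t := by simp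
  rw [Complex.add_im, Complex.sub_im, h3, Complex.zero_im] at h2
  nlinarith [mul_pos hdR ht]

theorem coeff_contract {σ : Type*} (a b : σ) (d : ℕ) (G : MvPolynomial σ ℂ) (m : σ →₀ ℕ) :
    MvPolynomial.coeff m (contract a b d G) =
      MvPolynomial.coeff m G * (1 - m a / d) - 1 / d *
        (MvPolynomial.coeff (m + Finsupp.single b 1 + Finsupp.single a 1) G *
          ((m + Finsupp.single b 1 : σ →₀ ℕ) a + 1) * (m b + 1)) := by
  classical
  have h : MvPolynomial.coeff m (MvPolynomial.X a * MvPolynomial.pderiv a G) =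
      MvPolynomial.coeff m G * m a := by
    rw [MvPolynomial.coeff_X_mul']
    split_ifs with hm
    · have h1 : 1 ≤ m a := Nat.one_le_iff_ne_zero.2 (Finsupp.mem_support_iff.1 hm)
      have h2 : m - Finsupp.single a 1 + Finsupp.single a 1 = m :=
        tsub_add_cancel_of_le (Finsupp.single_le_iff.2 h1)
      rw [MvPolynomial.coeff_pderiv, h2, Finsupp.tsub_apply, Finsupp.single_eq_same,
        Nat.cast_sub h1]
      push_cast
      ring
    · rw [Finsupp.notMem_support_iff.1 hm]
      simp
  rw [contract, MvPolynomial.coeff_sub, MvPolynomial.coeff_smul, MvPolynomial.coeff_add, h,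
    MvPolynomial.coeff_pderiv, MvPolynomial.coeff_pderiv, smul_eq_mul]
  ring

theorem coeff_eq_zero_of_degreeOf_lt {σ : Type*} {G : MvPolynomial σ ℂ} {a : σ} {m : σ →₀ ℕ}
    (h : G.degreeOf a < m a) : MvPolynomial.coeff m G = 0 := by
  by_contra h0
  exact absurd (MvPolynomial.monomial_le_degreeOf a (MvPolynomial.mem_support_iff.2 h0)) (by omega)

theorem degreeOf_contract_lt {σ : Type*} {a b : σ} {d : ℕ} {G : MvPolynomial σ ℂ} (hd : 0 < d)
    (hG : G.degreeOf a ≤ d) : (contract a b d G).degreeOf a < d := by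
  rw [MvPolynomial.degreeOf_lt_iff hd]
  intro m hm
  by_contra! h
  refine MvPolynomial.mem_support_iff.1 hm ?_
  have hdC : (d : ℂ) ≠ 0 := by exact_mod_cast hd.ne'
  have h1 : MvPolynomial.coeff m G * (1 - m a / d : ℂ) = 0 := by
    rcases h.eq_or_lt with h | h
    · rw [← h, div_self hdC, sub_self, mul_zero]
    · rw [coeff_eq_zero_of_degreeOf_lt (a := a) (by omega), zero_mul]
  rw [coeff_contract, h1, coeff_eq_zero_of_degreeOf_lt (a := a)]
  · simp
  · simp only [Finsupp.add_apply, Finsupp.single_eq_same]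
    omega

theorem degreeOf_contract_le {σ : Type*} (a b i : σ) (d : ℕ) (G : MvPolynomial σ ℂ) :
    (contract a b d G).degreeOf i ≤ G.degreeOf i := by
  rw [MvPolynomial.degreeOf_le_iff]
  intro m hm
  by_contra! h
  refine MvPolynomial.mem_support_iff.1 hm ?_
  rw [coeff_contract, coeff_eq_zero_of_degreeOf_lt h, coeff_eq_zero_of_degreeOf_lt (a := i)]
  · simp
  · simp only [Finsupp.add_apply]
    omega

/-! ### Operators with stable symbol preserve stability -/

/-- The symbol of `∑ a_{αβ} z^α ∂^β` with the sign of the second variables changed, that is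
`∑ a_{αβ} z^α (-w)^β`, with `z_i` and `w_i` the variables `Sum.inl i` and `Sum.inr i`. -/
noncomputable def signedSymbol {n : ℕ} (a : WeylCoeffs n) : MvPolynomial (Fin n ⊕ Fin n) ℂ :=
  a.sum fun p c => MvPolynomial.monomial (p.1.sumElim p.2) (c * (-1) ^ ∑ i, p.2 i)

/-- The linear map `z^α u^β v^γ ↦ z^α (-∂)^β z^γ`. The variables `z_i`, `u_i`, `v_i` are
`Sum.inl i`, `Sum.inr (Sum.inl i)`, `Sum.inr (Sum.inr i)`. -/
noncomputable def contractAll (n : ℕ) :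
    MvPolynomial (Fin n ⊕ (Fin n ⊕ Fin n)) ℂ →ₗ[ℂ] MvPolynomial (Fin n) ℂ :=
  (MvPolynomial.basisMonomials _ ℂ).constr ℂ fun m =>
    MvPolynomial.monomial
      (Finsupp.equivFunOnFinite.symm fun i =>
        m (.inl i) + (m (.inr (.inr i)) - m (.inr (.inl i))))
      ((-1) ^ (∑ i, m (.inr (.inl i))) *
        (∏ i, (m (.inr (.inr i))).descFactorial (m (.inr (.inl i))) : ℕ))

theorem contractAll_monomial {n : ℕ} (m : Fin n ⊕ (Fin n ⊕ Fin n) →₀ ℕ) (c : ℂ) :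
    contractAll n (MvPolynomial.monomial m c) = MvPolynomial.monomial
      (Finsupp.equivFunOnFinite.symm fun i =>
        m (.inl i) + (m (.inr (.inr i)) - m (.inr (.inl i))))
      (c * ((-1) ^ (∑ i, m (.inr (.inl i))) *
        (∏ i, (m (.inr (.inr i))).descFactorial (m (.inr (.inl i))) : ℕ))) := by
  have h : MvPolynomial.monomial m c = c • MvPolynomial.basisMonomials _ ℂ m := by
    rw [MvPolynomial.coe_basisMonomials, MvPolynomial.smul_monomial, smul_eq_mul, mul_one]
  rw [h, map_smul, contractAll, Module.Basis.constr_basis, MvPolynomial.smul_monomial, smul_eq_mul]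

/-- Under `contractAll` the operators `u_j` and `-∂_{v_j}` agree. Hence `contract` does not change
the value of `contractAll`. -/
theorem contractAll_X_mul_add_pderiv {n : ℕ} (j : Fin n)
    (H : MvPolynomial (Fin n ⊕ (Fin n ⊕ Fin n)) ℂ) :
    contractAll n (MvPolynomial.X (.inr (.inl j)) * H +
      MvPolynomial.pderiv (.inr (.inr j)) H) = 0 := by
  induction H using MvPolynomial.induction_on' with
  | add p q hp hq =>
    rw [mul_add, map_add (MvPolynomial.pderiv _), add_add_add_comm, map_add, hp, hq, add_zero]
  | monomial m c =>
    have hexp : ∀ i, (Finsupp.single (Sum.inr (Sum.inl j)) 1 + m :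
        Fin n ⊕ (Fin n ⊕ Fin n) →₀ ℕ) (.inr (.inl i)) = (if i = j then 1 else 0) +
          m (.inr (.inl i)) := by
      intro i
      simp [Finsupp.single_apply, eq_comm]
    have hexp' : ∀ i, (m - Finsupp.single (Sum.inr (Sum.inr j)) 1 :
        Fin n ⊕ (Fin n ⊕ Fin n) →₀ ℕ) (.inr (.inr i)) = m (.inr (.inr i)) -
          (if i = j then 1 else 0) := by
      intro i
      simp [Finsupp.single_apply, eq_comm]
    have hprod : ∏ i, (m (.inr (.inr i))).descFactorial ((if i = j then 1 else 0) +
          m (.inr (.inl i))) =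
        m (.inr (.inr j)) * ∏ i, (m (.inr (.inr i)) - (if i = j then 1 else 0)).descFactorial
          (m (.inr (.inl i))) := by
      rw [← Finset.mul_prod_erase _ _ (Finset.mem_univ j),
        ← Finset.mul_prod_erase _ _ (Finset.mem_univ j), ← mul_assoc, if_pos rfl]
      congr 1
      · rw [add_comm 1]
        rcases m (.inr (.inr j)) with _ | k
        · simp
        · rw [Nat.succ_descFactorial_succ, Nat.add_sub_cancel]
      · refine Finset.prod_congr rfl fun i hi => ?_
        rw [if_neg (Finset.ne_of_mem_erase hi), zero_add, Nat.sub_zero]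
    rw [MvPolynomial.X, MvPolynomial.monomial_mul, MvPolynomial.pderiv_monomial, map_add,
      contractAll_monomial, contractAll_monomial]
    simp only [hexp, hexp']
    have h1 : ∀ i, (Finsupp.single (Sum.inr (Sum.inl j)) 1 + m :
        Fin n ⊕ (Fin n ⊕ Fin n) →₀ ℕ) (.inl i) = m (.inl i) := by simp
    have h2 : ∀ i, (Finsupp.single (Sum.inr (Sum.inl j)) 1 + m :
        Fin n ⊕ (Fin n ⊕ Fin n) →₀ ℕ) (.inr (.inr i)) = m (.inr (.inr i)) := by simp
    have h3 : ∀ i, (m - Finsupp.single (Sum.inr (Sum.inr j)) 1 :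
        Fin n ⊕ (Fin n ⊕ Fin n) →₀ ℕ) (.inl i) = m (.inl i) := by simp
    have h4 : ∀ i, (m - Finsupp.single (Sum.inr (Sum.inr j)) 1 :
        Fin n ⊕ (Fin n ⊕ Fin n) →₀ ℕ) (.inr (.inl i)) = m (.inr (.inl i)) := by simp
    simp only [h1, h2, h3, h4, hprod, Nat.sub_sub, Finset.sum_add_distrib, Finset.sum_ite_eq',
      Finset.mem_univ, if_true]
    rw [← map_add]
    convert MvPolynomial.monomial_zero
    push_cast
    ring

theorem contractAll_contract {n : ℕ} (j : Fin n) (d : ℕ)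
    (G : MvPolynomial (Fin n ⊕ (Fin n ⊕ Fin n)) ℂ) :
    contractAll n (contract (.inr (.inl j)) (.inr (.inr j)) d G) = contractAll n G := by
  rw [contract, map_sub, map_smul, contractAll_X_mul_add_pderiv, smul_zero, sub_zero]

theorem eval_contractAll_of_degreeOf_eq_zero {n : ℕ}
    {G : MvPolynomial (Fin n ⊕ (Fin n ⊕ Fin n)) ℂ} (hG : ∀ j, G.degreeOf (.inr (.inl j)) = 0)
    (x y : Fin n → ℂ) :
    MvPolynomial.eval x (contractAll n G) =
      MvPolynomial.eval (Sum.elim x (Sum.elim y x)) G := by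
  have h : ∀ m ∈ G.support, MvPolynomial.eval x (contractAll n (MvPolynomial.monomial m
      (MvPolynomial.coeff m G))) = MvPolynomial.eval (Sum.elim x (Sum.elim y x))
        (MvPolynomial.monomial m (MvPolynomial.coeff m G)) := by
    intro m hm
    have hu : ∀ j, m (.inr (.inl j)) = 0 := fun j =>
      Nat.le_zero.1 ((MvPolynomial.monomial_le_degreeOf _ hm).trans (hG j).le)
    rw [contractAll_monomial, MvPolynomial.eval_monomial, MvPolynomial.eval_monomial,
      Finsupp.prod_fintype _ _ (by simp), Finsupp.prod_fintype _ _ (by simp),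
      Fintype.prod_sum_type, Fintype.prod_sum_type]
    simp [hu, pow_add, Finset.prod_mul_distrib]
  conv_lhs => rw [G.as_sum]
  conv_rhs => rw [G.as_sum]
  rw [map_sum, map_sum, map_sum]
  exact Finset.sum_congr rfl h

/-- Each `u_i` is replaced by `-∂_{v_i}` by means of polar derivatives, which lower the degree in
`u_i` until it is zero; then `v` is set equal to `z`. -/
theorem UpperStable.contractAll {n : ℕ} {G : MvPolynomial (Fin n ⊕ (Fin n ⊕ Fin n)) ℂ}
    (hG : UpperStable G) : UpperStable (contractAll n G) ∨ _root_.contractAll n G = 0 := by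
  induction hN : ∑ j, G.degreeOf (.inr (.inl j)) using Nat.strong_induction_on generalizing G with
  | _ N ih =>
    subst hN
    by_cases h0 : ∀ j, G.degreeOf (.inr (.inl j)) = 0
    · left
      intro x hx
      rw [eval_contractAll_of_degreeOf_eq_zero h0 x x]
      refine hG _ fun i => ?_
      rcases i with i | i | i <;> exact hx i
    · push Not at h0
      obtain ⟨j, hj⟩ := h0
      have hd := Nat.pos_of_ne_zero hj
      rw [← contractAll_contract j (G.degreeOf (.inr (.inl j)))]
      rcases hG.contract (b := .inr (.inr j)) hd le_rfl with h | h
      · refine ih _ (Finset.sum_lt_sum (fun i _ => degreeOf_contract_le _ _ _ _ _)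
          ⟨j, Finset.mem_univ j, degreeOf_contract_lt hd le_rfl⟩) h rfl
      · right
        rw [h, map_zero]

theorem contractAll_signedSymbol_mul {n : ℕ} (a : WeylCoeffs n) (f : MvPolynomial (Fin n) ℂ) :
    contractAll n (MvPolynomial.rename (Sum.map id Sum.inl) (signedSymbol a) *
      MvPolynomial.rename (Sum.inr ∘ Sum.inr) f) = normalForm n a f := by
  induction f using MvPolynomial.induction_on' with
  | add p q hp hq => rw [map_add, mul_add, map_add, hp, hq, map_add]
  | monomial γ b =>
    rw [signedSymbol, normalForm, Finsupp.linearCombination_apply, Finsupp.sum, Finsupp.sum,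
      map_sum, Finset.sum_mul, map_sum, LinearMap.sum_apply]
    refine Finset.sum_congr rfl fun p _ => ?_
    have hinj : Function.Injective (Sum.map id Sum.inl : Fin n ⊕ Fin n → Fin n ⊕ (Fin n ⊕ Fin n)) :=
      Sum.map_injective.2 ⟨Function.injective_id, Sum.inl_injective⟩
    have hinj' : Function.Injective (Sum.inr ∘ Sum.inr : Fin n → Fin n ⊕ (Fin n ⊕ Fin n)) :=
      Sum.inr_injective.comp Sum.inr_injective
    have hm : Finsupp.mapDomain (Sum.map id Sum.inl) (p.1.sumElim p.2) +
        Finsupp.mapDomain (Sum.inr ∘ Sum.inr) γ = p.1.sumElim (p.2.sumElim γ) := by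
      ext i
      rw [Finsupp.add_apply]
      rcases i with i | i | i
      · rw [Finsupp.mapDomain_of_notMem_range γ _ (by simp)]
        simpa using Finsupp.mapDomain_apply hinj (p.1.sumElim p.2) (.inl i)
      · rw [Finsupp.mapDomain_of_notMem_range γ _ (by simp)]
        simpa using Finsupp.mapDomain_apply hinj (p.1.sumElim p.2) (.inr i)
      · rw [Finsupp.mapDomain_of_notMem_range (p.1.sumElim p.2) _ (by simp)]
        simpa using Finsupp.mapDomain_apply hinj' γ i
    rw [MvPolynomial.rename_monomial, MvPolynomial.rename_monomial, MvPolynomial.monomial_mul, hm,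
      contractAll_monomial, LinearMap.smul_apply, monomialOp_monomial, MvPolynomial.smul_monomial]
    have hexp : (Finsupp.equivFunOnFinite.symm fun i => p.1 i + (γ i - p.2 i)) =
        p.1 + (γ - p.2) := by
      ext i
      simp
    have hs : ((-1 : ℂ) ^ ∑ i, p.2 i) * (-1) ^ ∑ i, p.2 i = 1 := by
      rw [← mul_pow]
      simp
    simp only [Finsupp.sumElim_inl, Finsupp.sumElim_inr, hexp, smul_eq_mul]
    congr 1
    linear_combination (a p * b * (∏ i, (γ i).descFactorial (p.2 i) : ℕ)) * hs

theorem UpperStable.normalForm {n : ℕ} {a : WeylCoeffs n} (ha : UpperStable (signedSymbol a))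
    {f : MvPolynomial (Fin n) ℂ} (hf : UpperStable f) :
    UpperStable (normalForm n a f) ∨ _root_.normalForm n a f = 0 := by
  rw [← contractAll_signedSymbol_mul]
  refine UpperStable.contractAll fun z hz => ?_
  rw [map_mul, MvPolynomial.eval_rename, MvPolynomial.eval_rename]
  exact mul_ne_zero (ha _ fun i => hz _) (hf _ fun i => hz _)

/-! ### The signed symbol and the adjoint -/

theorem signedSymbol_ne_zero {n : ℕ} {a : WeylCoeffs n} (ha : a ≠ 0) : signedSymbol a ≠ 0 := by
  obtain ⟨p, hp⟩ := Finsupp.support_nonempty_iff.2 ha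
  intro h
  have h1 := congrArg (MvPolynomial.coeff (p.1.sumElim p.2)) h
  rw [signedSymbol, Finsupp.sum, MvPolynomial.coeff_sum, Finset.sum_eq_single_of_mem p hp,
    MvPolynomial.coeff_monomial, if_pos rfl, MvPolynomial.coeff_zero] at h1
  · exact mul_ne_zero (Finsupp.mem_support_iff.1 hp) (by simp) h1
  · intro q _ hqp
    rw [MvPolynomial.coeff_monomial, if_neg]
    intro he
    refine hqp (Prod.ext (Finsupp.ext fun i => ?_) (Finsupp.ext fun i => ?_))
    · simpa using DFunLike.congr_fun he (Sum.inl i)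
    · simpa using DFunLike.congr_fun he (Sum.inr i)

theorem eval_signedSymbol {n : ℕ} (a : WeylCoeffs n) (x : Fin n ⊕ Fin n → ℂ) :
    MvPolynomial.eval x (signedSymbol a) = a.sum fun p c =>
      c * ((∏ i, x (.inl i) ^ p.1 i) * ∏ i, (-x (.inr i)) ^ p.2 i) := by
  rw [signedSymbol, Finsupp.sum, map_sum]
  refine Finset.sum_congr rfl fun p _ => ?_
  rw [MvPolynomial.eval_monomial, Finsupp.prod_fintype _ _ (by simp), Fintype.prod_sum_type,
    ← Finset.prod_pow_eq_pow_sum]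
  simp only [Finsupp.sumElim_inl, Finsupp.sumElim_inr, fun i => neg_pow (x (.inr i)) (p.2 i),
    Finset.prod_mul_distrib]
  ring

theorem adjointCoeffs_adjointCoeffs {n : ℕ} (a : WeylCoeffs n) :
    adjointCoeffs (adjointCoeffs a) = a := by
  ext p
  simp [adjointCoeffs, Finsupp.equivMapDomain_apply]

theorem eval_signedSymbol_adjointCoeffs {n : ℕ} (a : WeylCoeffs n) (x : Fin n ⊕ Fin n → ℂ) :
    MvPolynomial.eval x (signedSymbol (adjointCoeffs a)) = starRingEnd ℂ
      (MvPolynomial.eval (fun i => -starRingEnd ℂ (x i.swap)) (signedSymbol a)) := by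
  rw [eval_signedSymbol, eval_signedSymbol, adjointCoeffs, Finsupp.sum_equivMapDomain,
    Finsupp.sum_mapRange_index (by simp), Finsupp.sum, Finsupp.sum, map_sum]
  refine Finset.sum_congr rfl fun p _ => ?_
  simp only [map_mul, map_prod, map_pow, map_neg, Complex.conj_conj, Sum.swap_inl, Sum.swap_inr,
    neg_neg, Equiv.coe_prodComm, Prod.fst_swap, Prod.snd_swap]
  ring

/-- Passing to the adjoint corresponds to the symmetry `(z, w) ↦ (-conj w, -conj z)` of the product
of upper half planes. -/
theorem UpperStable.adjointCoeffs {n : ℕ} {a : WeylCoeffs n} (ha : UpperStable (signedSymbol a)) :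
    UpperStable (signedSymbol (adjointCoeffs a)) := fun x hx => by
  rw [eval_signedSymbol_adjointCoeffs, map_ne_zero]
  exact ha _ fun i => by simpa using hx _

/-! ### Images of polynomials under operators that preserve real stability -/

/-- The polynomial with conjugated coefficients. -/
noncomputable def conjPoly {σ : Type*} (f : MvPolynomial σ ℂ) : MvPolynomial σ ℂ :=
  MvPolynomial.map (starRingEnd ℂ) f

theorem eval_conjPoly {σ : Type*} (z : σ → ℂ) (f : MvPolynomial σ ℂ) :
    MvPolynomial.eval z (conjPoly f) =
      starRingEnd ℂ (MvPolynomial.eval (fun i => starRingEnd ℂ (z i)) f) := by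
  induction f using MvPolynomial.induction_on with
  | C c => simp [conjPoly]
  | add p q hp hq => simp only [conjPoly, map_add] at hp hq ⊢; rw [hp, hq]
  | mul_X p i hp => simp only [conjPoly, map_mul] at hp ⊢; rw [hp]; simp

/-- A weak form of the Hermite–Biehler theorem. -/
theorem UpperStable.norm_eval_conj_le {σ : Type*} {h : MvPolynomial σ ℂ} (hh : UpperStable h)
    {z : σ → ℂ} (hz : ∀ i, 0 < (z i).im) :
    ‖MvPolynomial.eval (fun i => starRingEnd ℂ (z i)) h‖ ≤ ‖MvPolynomial.eval z h‖ := by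
  obtain ⟨q, hq, -⟩ := exists_line_polynomial (fun i => ((z i).re : ℂ))
    (fun i => (z i).re + (z i).im) h
  have h1 : q.eval Complex.I = MvPolynomial.eval z h := by
    rw [hq]
    congr 2
    ext i
    apply Complex.ext <;> simp
  have h2 : q.eval (-Complex.I) = MvPolynomial.eval (fun i => starRingEnd ℂ (z i)) h := by
    rw [hq]
    congr 2
    ext i
    apply Complex.ext <;> simp
  rw [← h1, ← h2]
  refine Polynomial.norm_eval_neg_I_le fun u hu => ?_
  rw [hq]
  refine hh _ fun i => ?_
  simpa using mul_pos hu (hz i)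

/-- A polynomial is one-sided if it is zero or has no zeros on one of the two products of half
planes: the upper ones, or the lower ones. -/
def IsOneSided {σ : Type*} (k : MvPolynomial σ ℂ) : Prop :=
  UpperStable k ∨ UpperStable (conjPoly k) ∨ k = 0

/-- A multivariate Hermite–Kakeya–Obreschkoff theorem. Without zeros, the real pencil forces
`‖k z‖ ≠ ‖k (conj z)‖` on the product of half planes, and by connectedness the same one of the two
is the larger everywhere. -/
theorem isOneSided_of_real_pencil {σ : Type*} {k : MvPolynomial σ ℂ}
    (hk : ∀ c : ℂ, c ≠ 0 → UpperStable (c • k + starRingEnd ℂ c • conjPoly k) ∨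
      c • k + starRingEnd ℂ c • conjPoly k = 0) : IsOneSided k := by
  by_cases h0 : ∃ c : ℂ, c ≠ 0 ∧ c • k + starRingEnd ℂ c • conjPoly k = 0
  -- If one member of the pencil is zero, then another one is a nonzero multiple of `k`.
  · obtain ⟨c, hc, h⟩ := h0
    have h2 : (Complex.I * c) • k + starRingEnd ℂ (Complex.I * c) • conjPoly k =
        (2 * Complex.I * c) • k := by
      have h3 : starRingEnd ℂ (Complex.I * c) • conjPoly k =
          -(Complex.I • (starRingEnd ℂ c • conjPoly k)) := by
        rw [map_mul, Complex.conj_I, smul_smul, neg_mul, neg_smul]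
      rw [h3, ← neg_eq_of_add_eq_zero_right h, smul_neg, neg_neg, smul_smul, ← add_smul]
      congr 1
      ring
    have hIc : Complex.I * c ≠ 0 := mul_ne_zero Complex.I_ne_zero hc
    rcases hk _ hIc with h3 | h3
    · rw [h2] at h3
      exact Or.inl h3.of_smul
    · rw [h2, smul_eq_zero] at h3
      refine Or.inr (Or.inr (h3.resolve_left ?_))
      rw [mul_assoc]
      exact mul_ne_zero two_ne_zero hIc
  · push Not at h0
    have hst : ∀ c : ℂ, c ≠ 0 → UpperStable (c • k + starRingEnd ℂ c • conjPoly k) :=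
      fun c hc => (hk c hc).resolve_right (h0 c hc)
    set φ : (σ → ℂ) → ℝ := fun z =>
      ‖MvPolynomial.eval z k‖ - ‖MvPolynomial.eval (fun i => starRingEnd ℂ (z i)) k‖ with hφ
    have hne : ∀ z : σ → ℂ, (∀ i, 0 < (z i).im) → φ z ≠ 0 := by
      intro z hz h
      set A := MvPolynomial.eval z k with hA
      set B := MvPolynomial.eval (fun i => starRingEnd ℂ (z i)) k with hB
      have hAB : ‖A‖ = ‖B‖ := sub_eq_zero.1 h
      -- If `‖A‖ = ‖B‖`, a member of the pencil vanishes at `z`.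
      have hc : ∃ c : ℂ, c ≠ 0 ∧ c * A + starRingEnd ℂ c * starRingEnd ℂ B = 0 := by
        by_cases hA0 : A = 0
        · have : B = 0 := by rw [← norm_eq_zero, ← hAB, hA0, norm_zero]
          exact ⟨1, one_ne_zero, by simp [hA0, this]⟩
        · obtain ⟨c, hc⟩ := IsAlgClosed.exists_eq_mul_self (-(starRingEnd ℂ B) / A)
          have hn : ‖c‖ = 1 := by
            have h1 : ‖c‖ * ‖c‖ = 1 := by
              rw [← norm_mul, ← hc, norm_div, norm_neg, RCLike.norm_conj, ← hAB,
                div_self (norm_ne_zero_iff.2 hA0)]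
            nlinarith [norm_nonneg c]
          have hc0 : c ≠ 0 := by
            rintro rfl
            simp at hn
          have hcc : starRingEnd ℂ c * c = 1 := by
            rw [mul_comm, Complex.mul_conj, Complex.normSq_eq_norm_sq, hn]
            simp
          refine ⟨c, hc0, ?_⟩
          rw [div_eq_iff hA0] at hc
          linear_combination (-starRingEnd ℂ c) * hc - c * A * hcc
      obtain ⟨c, hc0, hc⟩ := hc
      refine hst c hc0 z hz ?_
      rw [map_add, MvPolynomial.smul_eval, MvPolynomial.smul_eval, eval_conjPoly]
      exact hc
    have hcont : Continuous φ := by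
      have h1 : Continuous fun z : σ → ℂ => MvPolynomial.eval z k := MvPolynomial.continuous_eval k
      have h2 : Continuous fun z : σ → ℂ => (fun i => starRingEnd ℂ (z i)) := by fun_prop
      exact h1.norm.sub (h1.comp h2).norm
    have hconv : Convex ℝ {z : σ → ℂ | ∀ i, 0 < (z i).im} := by
      intro x hx y hy s t hs ht hst i
      have := hx i
      have := hy i
      simp only [Pi.add_apply, Pi.smul_apply, Complex.add_im, Complex.real_smul,
        Complex.im_ofReal_mul]
      rcases hs.eq_or_lt with rfl | hs
      · have : t = 1 := by linarith
        subst this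
        linarith
      · have := mul_pos hs (hx i)
        have := mul_nonneg ht (hy i).le
        linarith
    have hI : (fun _ => Complex.I) ∈ {z : σ → ℂ | ∀ i, 0 < (z i).im} := by simp
    rcases lt_or_gt_of_ne (hne _ hI) with hlt | hgt
    · refine Or.inr (Or.inl fun z hz h => ?_)
      rw [eval_conjPoly, map_eq_zero] at h
      have hz' : 0 ≤ φ z := by simp [hφ, h]
      obtain ⟨y, hy, hy0⟩ := hconv.isPreconnected.intermediate_value hI hz hcont.continuousOn
        ⟨hlt.le, hz'⟩
      exact hne y hy hy0
    · refine Or.inl fun z hz h => ?_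
      have hz' : φ z ≤ 0 := by simp [hφ, h]
      obtain ⟨y, hy, hy0⟩ := hconv.isPreconnected.intermediate_value hz hI hcont.continuousOn
        ⟨hz', hgt.le⟩
      exact hne y hy hy0

theorem normalForm_conjPoly {n : ℕ} {a : WeylCoeffs n} (ha : ∀ p, (a p).im = 0)
    (f : MvPolynomial (Fin n) ℂ) :
    normalForm n a (conjPoly f) = conjPoly (normalForm n a f) := by
  induction f using MvPolynomial.induction_on' with
  | add p q hp hq =>
    simp only [conjPoly, map_add] at hp hq ⊢
    rw [hp, hq]
  | monomial γ b =>
    simp only [conjPoly, normalForm, Finsupp.linearCombination_apply, Finsupp.sum,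
      LinearMap.sum_apply, map_sum, LinearMap.smul_apply, MvPolynomial.map_monomial,
      monomialOp_monomial, MvPolynomial.smul_monomial, smul_eq_mul, map_mul, map_natCast]
    refine Finset.sum_congr rfl fun p _ => ?_
    rw [Complex.conj_eq_iff_im.2 (ha p)]

/-- The operator with coefficients `a` preserves stability, or it has real coefficients and
preserves real stability. -/
def PreservesStability {n : ℕ} (a : WeylCoeffs n) : Prop :=
  (∀ f, IsStable f → IsStable (normalForm n a f) ∨ normalForm n a f = 0) ∨
  ((∀ p, (a p).im = 0) ∧
    ∀ f, IsRealStable f → IsRealStable (normalForm n a f) ∨ normalForm n a f = 0)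

/-- In the real case the strict inequality makes `c h + conj c * conjPoly h` real stable for all
`c ≠ 0`, so that `isOneSided_of_real_pencil` applies to the image of `h`. -/
theorem PreservesStability.isOneSided {n : ℕ} {a : WeylCoeffs n} (ha : PreservesStability a)
    {h : MvPolynomial (Fin n) ℂ} (hh : UpperStable h)
    (hlt : ∀ z : Fin n → ℂ, (∀ i, 0 < (z i).im) →
      ‖MvPolynomial.eval (fun i => starRingEnd ℂ (z i)) h‖ < ‖MvPolynomial.eval z h‖) :
    IsOneSided (normalForm n a h) := by
  rcases ha with ha | ⟨hreal, ha⟩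
  · exact (ha h hh).imp id Or.inr
  refine isOneSided_of_real_pencil fun c hc => ?_
  rw [← normalForm_conjPoly hreal, ← map_smul, ← map_smul, ← map_add]
  refine (ha _ ⟨fun z hz h0 => ?_, fun m => ?_⟩).imp (fun h => h.1) id
  · rw [map_add, MvPolynomial.smul_eval, MvPolynomial.smul_eval, eval_conjPoly] at h0
    have h1 := congrArg norm (eq_neg_of_add_eq_zero_left h0)
    rw [norm_neg, norm_mul, norm_mul, RCLike.norm_conj, RCLike.norm_conj] at h1
    exact (hlt z hz).ne' (mul_left_cancel₀ (norm_ne_zero_iff.2 hc) h1)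
  · rw [MvPolynomial.coeff_add, MvPolynomial.coeff_smul, MvPolynomial.coeff_smul, conjPoly,
      MvPolynomial.coeff_map, smul_eq_mul, smul_eq_mul, ← map_mul]
    simp
    ring

/-! ### Taylor expansion and operators applied to translated monomials -/

/-- The substitution `f ↦ f (z + c)`. -/
noncomputable def polyShift {n : ℕ} (c : Fin n → ℂ) :
    MvPolynomial (Fin n) ℂ →ₐ[ℂ] MvPolynomial (Fin n) ℂ :=
  MvPolynomial.aeval fun i => MvPolynomial.X i + MvPolynomial.C (c i)

theorem eval_polyShift {n : ℕ} (c z : Fin n → ℂ) (f : MvPolynomial (Fin n) ℂ) :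
    MvPolynomial.eval z (polyShift c f) = MvPolynomial.eval (fun i => z i + c i) f := by
  induction f using MvPolynomial.induction_on with
  | C b => simp [polyShift]
  | add p q hp hq => rw [map_add, map_add, map_add, hp, hq]
  | mul_X p i hp => rw [map_mul, map_mul, map_mul, hp]; simp [polyShift]

theorem partialOp_polyShift {n : ℕ} (i : Fin n) (c : Fin n → ℂ) (f : MvPolynomial (Fin n) ℂ) :
    partialOp i (polyShift c f) = polyShift c (partialOp i f) := by
  simp only [partialOp, Derivation.coeFn_coe]
  induction f using MvPolynomial.induction_on with
  | C b => simp [polyShift]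
  | add p q hp hq => simp only [map_add, hp, hq]
  | mul_X p j hp =>
    simp only [map_mul, MvPolynomial.pderiv_mul, map_add, hp]
    by_cases h : j = i
    · subst h; simp [polyShift]
    · simp [polyShift, MvPolynomial.pderiv_X_of_ne h]

theorem partialPow_polyShift {n : ℕ} (β : Fin n →₀ ℕ) (c : Fin n → ℂ)
    (f : MvPolynomial (Fin n) ℂ) :
    partialPow β (polyShift c f) = polyShift c (partialPow β f) := by
  have h : ∀ i ∈ Finset.univ, Commute (polyShift c).toLinearMap (partialOp i ^ β i) := fun i _ =>
    Commute.pow_right (LinearMap.ext fun g => (partialOp_polyShift i c g).symm) _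
  exact (LinearMap.congr_fun (Finset.noncommProd_commute Finset.univ _
    (partialOp_pairwise β Finset.univ) _ h) f).symm

theorem eval_zero_partialPow {n : ℕ} (β : Fin n →₀ ℕ) (f : MvPolynomial (Fin n) ℂ) :
    MvPolynomial.eval 0 (partialPow β f) =
      (∏ i, (β i).factorial : ℕ) * MvPolynomial.coeff β f := by
  induction f using MvPolynomial.induction_on' with
  | add p q hp hq => rw [map_add, map_add, hp, hq, MvPolynomial.coeff_add, mul_add]
  | monomial γ b =>
    rw [partialPow_monomial, MvPolynomial.coeff_monomial]
    rw [MvPolynomial.eval_zero]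
    split_ifs with h
    · subst h
      simp only [tsub_self, Nat.descFactorial_self]
      rw [MvPolynomial.constantCoeff_monomial, if_pos rfl, mul_comm]
    · rw [mul_zero]
      by_cases hle : γ ≤ β
      · obtain ⟨i, hi⟩ : ∃ i, γ i < β i := by
          by_contra! h'
          exact h (le_antisymm hle h')
        rw [Finset.prod_eq_zero (Finset.mem_univ i) (Nat.descFactorial_of_lt hi)]
        simp
      · rw [MvPolynomial.constantCoeff_monomial, if_neg]
        rwa [tsub_eq_zero_iff_le]

/-- Values of `T f` at `c` in terms of the Taylor coefficients of `f` at `c`. -/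
theorem eval_normalForm {n : ℕ} (a : WeylCoeffs n) (c : Fin n → ℂ) (f : MvPolynomial (Fin n) ℂ) :
    MvPolynomial.eval c (normalForm n a f) = a.sum fun p b => b * ((∏ i, c i ^ p.1 i) *
      ((∏ i, (p.2 i).factorial : ℕ) * MvPolynomial.coeff p.2 (polyShift c f))) := by
  rw [normalForm, Finsupp.linearCombination_apply, Finsupp.sum, Finsupp.sum, LinearMap.sum_apply,
    map_sum]
  refine Finset.sum_congr rfl fun p _ => ?_
  rw [← eval_zero_partialPow, partialPow_polyShift, eval_polyShift, LinearMap.smul_apply,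
    MvPolynomial.smul_eval, monomialOp, Module.End.mul_apply, mulOp, LinearMap.mulLeft_apply,
    map_mul, MvPolynomial.eval_monomial, Finsupp.prod_fintype _ _ (by simp)]
  simp

theorem eval_normalForm_eq_zero {n : ℕ} {a : WeylCoeffs n} {c : Fin n → ℂ}
    {f : MvPolynomial (Fin n) ℂ} {j : Fin n} {M : ℕ} (hM : ∀ p ∈ a.support, p.2 j < M)
    (hf : (MvPolynomial.X j - MvPolynomial.C (c j)) ^ M ∣ f) :
    MvPolynomial.eval c (normalForm n a f) = 0 := by
  obtain ⟨g, rfl⟩ := hf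
  rw [eval_normalForm]
  refine Finset.sum_eq_zero fun p hp => ?_
  beta_reduce
  have h1 : polyShift c ((MvPolynomial.X j - MvPolynomial.C (c j)) ^ M) =
      MvPolynomial.monomial (Finsupp.single j M) 1 := by
    rw [← MvPolynomial.X_pow_eq_monomial]
    simp [polyShift]
  rw [map_mul, h1, MvPolynomial.coeff_monomial_mul', if_neg]
  · simp
  · rw [Finsupp.single_le_iff]
    exact (hM p hp).not_ge

/-- The image of `(z - c)^β Q` at `c`, for `β` of maximal degree among the orders of derivatives
in `T`: only the terms with `∂^β` contribute. -/
theorem eval_normalForm_polyShift_neg {n : ℕ} {a : WeylCoeffs n} {β : Fin n →₀ ℕ}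
    (hβ : ∀ p ∈ a.support, p.2.degree ≤ β.degree) (c : Fin n → ℂ) (Q : MvPolynomial (Fin n) ℂ) :
    MvPolynomial.eval c (normalForm n a
        (polyShift (fun i => -c i) (MvPolynomial.monomial β 1) * Q)) =
      (∏ i, (β i).factorial : ℕ) * MvPolynomial.eval c Q *
        ∑ p ∈ a.support with p.2 = β, a p * ∏ i, c i ^ p.1 i := by
  have h1 : polyShift c (polyShift (fun i => -c i) (MvPolynomial.monomial β 1)) =
      MvPolynomial.monomial β 1 := by
    refine MvPolynomial.funext fun z => ?_
    rw [eval_polyShift, eval_polyShift]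
    simp
  rw [eval_normalForm, Finsupp.sum, Finset.mul_sum, Finset.sum_filter]
  refine Finset.sum_congr rfl fun p hp => ?_
  rw [map_mul, h1, MvPolynomial.coeff_monomial_mul']
  split_ifs with h2 h3 h3
  · rw [h3, tsub_self, one_mul]
    have : MvPolynomial.coeff 0 (polyShift c Q) = MvPolynomial.eval c Q := by
      have h := eval_polyShift c 0 Q
      simp only [Pi.zero_apply, zero_add] at h
      rw [← h, MvPolynomial.eval_zero, MvPolynomial.constantCoeff_eq]
    rw [this]
    ring
  · exfalso
    obtain ⟨e, he⟩ := exists_add_of_le h2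
    have h4 := hβ p hp
    rw [he, map_add] at h4
    have h5 : e.degree = 0 := by omega
    rw [Finsupp.degree_eq_zero_iff] at h5
    exact h3 (by rw [he, h5, add_zero])
  · exact absurd h3.ge h2
  · simp

theorem polyShift_monomial {n : ℕ} (w : Fin n → ℂ) (γ : Fin n →₀ ℕ) :
    polyShift w (MvPolynomial.monomial γ 1) =
      ∏ i, (MvPolynomial.X i + MvPolynomial.C (w i)) ^ γ i := by
  rw [polyShift, MvPolynomial.aeval_monomial, Finsupp.prod_fintype _ _ (by simp)]
  simp

theorem upperStable_X_add_C {n : ℕ} {j : Fin n} {w : ℂ} (hw : 0 < w.im) :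
    UpperStable (MvPolynomial.X j + MvPolynomial.C w) := fun z hz h => by
  have := congrArg Complex.im h
  simp only [map_add, MvPolynomial.eval_X, MvPolynomial.eval_C, Complex.add_im,
    Complex.zero_im] at this
  linarith [hz j]

theorem upperStable_polyShift_monomial {n : ℕ} {w : Fin n → ℂ} (hw : ∀ i, 0 < (w i).im)
    (γ : Fin n →₀ ℕ) : UpperStable (polyShift w (MvPolynomial.monomial γ 1)) := fun z hz => by
  rw [polyShift_monomial, map_prod]
  refine Finset.prod_ne_zero_iff.2 fun i _ => ?_
  rw [map_pow]
  exact pow_ne_zero _ (upperStable_X_add_C (hw i) z hz)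

/-- A linear factor makes the Hermite–Biehler inequality strict. -/
theorem PreservesStability.isOneSided_mul {n : ℕ} {a : WeylCoeffs n} (ha : PreservesStability a)
    {j : Fin n} {w : ℂ} (hw : 0 < w.im) {g : MvPolynomial (Fin n) ℂ} (hg : UpperStable g) :
    IsOneSided (normalForm n a ((MvPolynomial.X j + MvPolynomial.C w) * g)) := by
  refine ha.isOneSided ((upperStable_X_add_C hw).mul hg) fun z hz => ?_
  rw [map_mul, map_mul, norm_mul, norm_mul]
  refine (mul_le_mul_of_nonneg_left (hg.norm_eval_conj_le hz) (norm_nonneg _)).trans_lt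
    (mul_lt_mul_of_pos_right ?_ (norm_pos_iff.2 (hg z hz)))
  simp only [map_add, MvPolynomial.eval_X, MvPolynomial.eval_C]
  rw [← sq_lt_sq₀ (norm_nonneg _) (norm_nonneg _), ← Complex.normSq_eq_norm_sq,
    ← Complex.normSq_eq_norm_sq, Complex.normSq_apply, Complex.normSq_apply]
  simp only [Complex.add_re, Complex.add_im, Complex.conj_re, Complex.conj_im]
  nlinarith [mul_pos (hz j) hw]

/-- On the product of upper half planes, `f` is dominated by a multiple of `g`. -/
def IsDominated {n : ℕ} (f g : MvPolynomial (Fin n) ℂ) : Prop :=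
  ∃ K : ℝ, 0 ≤ K ∧ ∀ z : Fin n → ℂ, (∀ i, 0 < (z i).im) →
    ‖MvPolynomial.eval z f‖ ≤ K * ‖MvPolynomial.eval z g‖

namespace IsDominated

variable {n : ℕ} {f g f' g' : MvPolynomial (Fin n) ℂ}

theorem one : IsDominated (1 : MvPolynomial (Fin n) ℂ) 1 := ⟨1, zero_le_one, fun z _ => by simp⟩

theorem mul (h : IsDominated f g) (h' : IsDominated f' g') : IsDominated (f * f') (g * g') := by
  obtain ⟨K, hK, h⟩ := h
  obtain ⟨K', hK', h'⟩ := h'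
  refine ⟨K * K', mul_nonneg hK hK', fun z hz => ?_⟩
  rw [map_mul, map_mul, norm_mul, norm_mul]
  calc _ ≤ _ := mul_le_mul (h z hz) (h' z hz) (norm_nonneg _) (by positivity)
    _ = _ := by ring

theorem pow (h : IsDominated f g) (k : ℕ) : IsDominated (f ^ k) (g ^ k) := by
  induction k with
  | zero => simpa using one
  | succ k ih => rw [pow_succ, pow_succ]; exact ih.mul h

theorem prod {ι : Type*} (s : Finset ι) {f g : ι → MvPolynomial (Fin n) ℂ}
    (h : ∀ i ∈ s, IsDominated (f i) (g i)) : IsDominated (∏ i ∈ s, f i) (∏ i ∈ s, g i) := by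
  classical
  induction s using Finset.induction_on with
  | empty => simpa using one
  | insert i s hi ih =>
    rw [Finset.prod_insert hi, Finset.prod_insert hi]
    exact (h i (Finset.mem_insert_self i s)).mul
      (ih fun k hk => h k (Finset.mem_insert_of_mem hk))

theorem X_add_C (j : Fin n) (u : ℂ) {w : ℂ} (hw : 0 < w.im) :
    IsDominated (MvPolynomial.X j + MvPolynomial.C u) (MvPolynomial.X j + MvPolynomial.C w) := by
  refine ⟨1 + ‖u - w‖ / w.im, by positivity, fun z hz => ?_⟩
  simp only [map_add, MvPolynomial.eval_X, MvPolynomial.eval_C]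
  have h1 : w.im ≤ ‖z j + w‖ := by
    have := Complex.im_le_norm (z j + w)
    rw [Complex.add_im] at this
    linarith [hz j]
  calc ‖z j + u‖ = ‖(z j + w) + (u - w)‖ := by congr 1; ring
    _ ≤ ‖z j + w‖ + ‖u - w‖ := norm_add_le _ _
    _ ≤ ‖z j + w‖ + ‖u - w‖ / w.im * ‖z j + w‖ := by
        gcongr
        rw [div_mul_eq_mul_div, le_div_iff₀ hw]
        gcongr
    _ = _ := by ring

theorem exists_upperStable (h : IsDominated f g) (hg : UpperStable g) :
    ∃ ε : ℂ, ε ≠ 0 ∧ UpperStable (g + ε • f) := by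
  obtain ⟨K, hK, h⟩ := h
  refine ⟨((1 / (K + 1) : ℝ) : ℂ), ?_, fun z hz h0 => ?_⟩
  · exact_mod_cast (by positivity : (1 / (K + 1) : ℝ) ≠ 0)
  · rw [map_add, MvPolynomial.smul_eval] at h0
    have h1 := congrArg norm (eq_neg_of_add_eq_zero_left h0)
    have h2 : 0 < ‖MvPolynomial.eval z g‖ := norm_pos_iff.2 (hg z hz)
    rw [norm_neg, norm_mul, Complex.norm_real, Real.norm_of_nonneg (by positivity),
      one_div_mul_eq_div, eq_div_iff (by positivity)] at h1
    nlinarith [h z hz]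

end IsDominated

theorem exists_real_sum_ne_zero {n : ℕ} {a : WeylCoeffs n} {p : (Fin n →₀ ℕ) × (Fin n →₀ ℕ)}
    (hp : p ∈ a.support) : ∃ c : Fin n → ℂ, (∀ i, (c i).im = 0) ∧
      ∑ q ∈ a.support with q.2 = p.2, a q * ∏ i, c i ^ q.1 i ≠ 0 := by
  set P : MvPolynomial (Fin n) ℂ :=
    ∑ q ∈ a.support with q.2 = p.2, MvPolynomial.monomial q.1 (a q) with hP
  have hP0 : P ≠ 0 := by
    intro h
    have h1 := congrArg (MvPolynomial.coeff p.1) h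
    rw [hP, MvPolynomial.coeff_sum, Finset.sum_eq_single_of_mem p (by simpa using hp),
      MvPolynomial.coeff_monomial, if_pos rfl, MvPolynomial.coeff_zero] at h1
    · exact Finsupp.mem_support_iff.1 hp h1
    · intro q hq hqp
      rw [MvPolynomial.coeff_monomial, if_neg]
      exact fun h => hqp (Prod.ext h (Finset.mem_filter.1 hq).2)
  by_contra! hcon
  refine hP0 (MvPolynomial.funext_set (fun _ => Set.range ((↑) : ℝ → ℂ))
    (fun _ => Set.infinite_range_of_injective Complex.ofReal_injective) fun x hx => ?_)
  have hx' : ∀ i, (x i).im = 0 := fun i => by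
    obtain ⟨r, hr⟩ := hx i (Set.mem_univ i)
    rw [← hr, Complex.ofReal_im]
  rw [map_zero, ← hcon x hx', hP, map_sum]
  refine Finset.sum_congr rfl fun q _ => ?_
  rw [MvPolynomial.eval_monomial, Finsupp.prod_fintype _ _ (by simp)]

/-- If `T` killed `(z + w)^γ`, then it would map small perturbations of this polynomial, hence all
polynomials of multidegree at most `γ` with a factor `z_j + w_j`, to one-sided polynomials. This
fails for a multiple of a high power of `z_j^2 + 1`, whose image vanishes at `(i, …, i)` and
`(-i, …, -i)`, but, by the choice of `β` of maximal degree, not at the real point `c`. -/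
theorem PreservesStability.normalForm_polyShift_ne_zero {n : ℕ} {a : WeylCoeffs n}
    (ha : PreservesStability a) {β : Fin n →₀ ℕ} (hβ : ∀ p ∈ a.support, p.2.degree ≤ β.degree)
    (hβa : ∃ p ∈ a.support, p.2 = β) (j : Fin n) {M : ℕ} (hM : ∀ p ∈ a.support, p.2 j < M)
    {w : Fin n → ℂ} (hw : ∀ i, 0 < (w i).im) (ρ : Fin n →₀ ℕ) :
    normalForm n a (polyShift w
      (MvPolynomial.monomial (β + Finsupp.single j (2 * M + 1) + ρ) 1)) ≠ 0 := by
  intro h0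
  obtain ⟨p, hp, rfl⟩ := hβa
  obtain ⟨c, hc, hsum⟩ := exists_real_sum_ne_zero hp
  set L := MvPolynomial.X j + MvPolynomial.C (w j) with hL
  set R := polyShift w (MvPolynomial.monomial ρ 1) with hR
  set E := polyShift w (MvPolynomial.monomial p.2 1) * (L ^ M * L ^ M) with hE
  set F := polyShift (fun i => -c i) (MvPolynomial.monomial p.2 1) *
    ((MvPolynomial.X j + MvPolynomial.C Complex.I) ^ M *
      (MvPolynomial.X j + MvPolynomial.C (-Complex.I)) ^ M) with hF
  have hLs : UpperStable L := upperStable_X_add_C (hw j)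
  have hdom : IsDominated F E := by
    rw [hF, hE, polyShift_monomial, polyShift_monomial]
    refine (IsDominated.prod _ fun i _ => (IsDominated.X_add_C i _ (hw i)).pow _).mul
      (((IsDominated.X_add_C j _ (hw j)).pow M).mul ((IsDominated.X_add_C j _ (hw j)).pow M))
  have hLk : ∀ k, UpperStable (L ^ k) := fun k z hz => by
    rw [map_pow]
    exact pow_ne_zero _ (hLs z hz)
  obtain ⟨ε, hε, hst⟩ := hdom.exists_upperStable
    ((upperStable_polyShift_monomial hw p.2).mul ((hLk M).mul (hLk M)))
  have hone := ha.isOneSided_mul (j := j) (hw j)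
    ((upperStable_polyShift_monomial hw ρ).mul hst)
  have hfactor : polyShift w (MvPolynomial.monomial (p.2 + Finsupp.single j (2 * M + 1) + ρ) 1) =
      L * (R * E) := by
    have h1 : MvPolynomial.monomial (p.2 + Finsupp.single j (2 * M + 1) + ρ) (1 : ℂ) =
        MvPolynomial.monomial p.2 1 * MvPolynomial.X j ^ (2 * M + 1) *
          MvPolynomial.monomial ρ 1 := by
      rw [MvPolynomial.X_pow_eq_monomial, MvPolynomial.monomial_mul, MvPolynomial.monomial_mul]
      simp
    have h2 : polyShift w (MvPolynomial.X j) = L := by simp [polyShift, hL]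
    rw [h1, map_mul, map_mul, map_pow, h2, hE, hR]
    ring
  have himg : normalForm n a (L * (R * (E + ε • F))) = ε • normalForm n a (L * (R * F)) := by
    rw [mul_add, mul_add, map_add, ← hfactor, h0, zero_add, mul_smul_comm, mul_smul_comm, map_smul]
  rw [himg] at hone
  have hI : MvPolynomial.eval (fun _ => Complex.I) (normalForm n a (L * (R * F))) = 0 := by
    refine eval_normalForm_eq_zero hM ?_
    rw [sub_eq_add_neg, ← map_neg]
    exact Dvd.intro_left (L * R * polyShift (fun i => -c i) (MvPolynomial.monomial p.2 1) *
      (MvPolynomial.X j + MvPolynomial.C Complex.I) ^ M) (by rw [hF]; ring)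
  have hI' : MvPolynomial.eval (fun _ => -Complex.I) (normalForm n a (L * (R * F))) = 0 := by
    refine eval_normalForm_eq_zero hM ?_
    rw [sub_eq_add_neg, ← map_neg, neg_neg]
    exact Dvd.intro_left (L * R * polyShift (fun i => -c i) (MvPolynomial.monomial p.2 1) *
      (MvPolynomial.X j + MvPolynomial.C (-Complex.I)) ^ M) (by rw [hF]; ring)
  rcases hone with h | h | h
  · exact h (fun _ => Complex.I) (by simp) (by rw [MvPolynomial.smul_eval, hI, mul_zero])
  · refine h (fun _ => Complex.I) (by simp) ?_
    rw [eval_conjPoly]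
    simp only [Complex.conj_I]
    rw [MvPolynomial.smul_eval, hI', mul_zero, map_zero]
  · have h1 := (smul_eq_zero.1 h).resolve_left hε
    have h2 : L * (R * F) = polyShift (fun i => -c i) (MvPolynomial.monomial p.2 1) * (L * R *
        ((MvPolynomial.X j + MvPolynomial.C Complex.I) ^ M *
          (MvPolynomial.X j + MvPolynomial.C (-Complex.I)) ^ M)) := by
      rw [hF]; ring
    have h3 := eval_normalForm_polyShift_neg hβ c (L * R *
        ((MvPolynomial.X j + MvPolynomial.C Complex.I) ^ M *
          (MvPolynomial.X j + MvPolynomial.C (-Complex.I)) ^ M))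
    rw [← h2, h1, map_zero] at h3
    have hne : ∀ (i : Fin n) (u : ℂ), u.im ≠ 0 → c i + u ≠ 0 := fun i u hu h => by
      have := congrArg Complex.im h
      rw [Complex.add_im, hc, zero_add, Complex.zero_im] at this
      exact hu this
    refine mul_ne_zero (mul_ne_zero ?_ ?_) hsum h3.symm
    · exact_mod_cast (Finset.prod_pos fun i _ => Nat.factorial_pos _).ne'
    · rw [hL, hR, polyShift_monomial]
      simp only [map_mul, map_pow, map_add, map_prod, MvPolynomial.eval_X, MvPolynomial.eval_C]
      refine mul_ne_zero (mul_ne_zero (hne j _ (hw j).ne')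
        (Finset.prod_ne_zero_iff.2 fun i _ => pow_ne_zero _ (hne i _ (hw i).ne')))
        (mul_ne_zero (pow_ne_zero _ (hne j _ (by simp))) (pow_ne_zero _ (hne j _ (by simp))))

/-- The image of `(z + w)^γ` vanishes at `z = -w`, which excludes one of the two sides. -/
theorem PreservesStability.upperStable_normalForm_polyShift {n : ℕ} {a : WeylCoeffs n}
    (ha : PreservesStability a) {β : Fin n →₀ ℕ} (hβ : ∀ p ∈ a.support, p.2.degree ≤ β.degree)
    (hβa : ∃ p ∈ a.support, p.2 = β) (j : Fin n) {M : ℕ} (hM : ∀ p ∈ a.support, p.2 j < M)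
    {w : Fin n → ℂ} (hw : ∀ i, 0 < (w i).im) (ρ : Fin n →₀ ℕ) :
    UpperStable (normalForm n a (polyShift w
      (MvPolynomial.monomial (β + Finsupp.single j (2 * M + 1) + ρ) 1))) := by
  have hne := ha.normalForm_polyShift_ne_zero hβ hβa j hM hw ρ
  have h1 : MvPolynomial.monomial (β + Finsupp.single j (2 * M + 1) + ρ) (1 : ℂ) =
      MvPolynomial.X j * (MvPolynomial.X j ^ M * MvPolynomial.monomial
        (Finsupp.single j M + β + ρ) 1) := by
    rw [MvPolynomial.X_pow_eq_monomial, MvPolynomial.X, MvPolynomial.monomial_mul,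
      MvPolynomial.monomial_mul]
    congr 1
    · rw [show 2 * M + 1 = 1 + M + M by ring, Finsupp.single_add, Finsupp.single_add]
      ac_rfl
    · simp
  have h2 : polyShift w (MvPolynomial.X j) = MvPolynomial.X j + MvPolynomial.C (w j) := by
    simp [polyShift]
  have hLs := upperStable_X_add_C (j := j) (hw j)
  have h3 : polyShift w (MvPolynomial.monomial (β + Finsupp.single j (2 * M + 1) + ρ) 1) =
      (MvPolynomial.X j + MvPolynomial.C (w j)) * ((MvPolynomial.X j + MvPolynomial.C (w j)) ^ M *
        polyShift w (MvPolynomial.monomial (Finsupp.single j M + β + ρ) 1)) := by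
    rw [h1, map_mul, map_mul, map_pow, h2]
  rw [h3] at hne ⊢
  rcases ha.isOneSided_mul (j := j) (hw j) (g := (MvPolynomial.X j + MvPolynomial.C (w j)) ^ M *
    polyShift w (MvPolynomial.monomial (Finsupp.single j M + β + ρ) 1)) (UpperStable.mul
      (fun z hz => by rw [map_pow]; exact pow_ne_zero _ (hLs z hz))
      (upperStable_polyShift_monomial hw _)) with h | h | h
  · exact h
  · exfalso
    refine h (fun i => -starRingEnd ℂ (w i)) (fun i => by simpa using hw i) ?_
    rw [eval_conjPoly, map_eq_zero]
    refine eval_normalForm_eq_zero hM ?_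
    simp only [map_neg, Complex.conj_conj, sub_neg_eq_add]
    exact Dvd.intro_left ((MvPolynomial.X j + MvPolynomial.C (w j)) *
      polyShift w (MvPolynomial.monomial (Finsupp.single j M + β + ρ) 1)) (by ring)
  · exact absurd h hne

/-! ### The symbol of an operator that preserves stability -/

theorem eval_normalForm_polyShift_monomial {n : ℕ} (a : WeylCoeffs n) (w z : Fin n → ℂ)
    (γ : Fin n →₀ ℕ) :
    MvPolynomial.eval z (normalForm n a (polyShift w (MvPolynomial.monomial γ 1))) =
      a.sum fun p b => b * ((∏ i, z i ^ p.1 i) *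
        ∏ i, ((γ i).descFactorial (p.2 i) * (z i + w i) ^ (γ i - p.2 i))) := by
  rw [normalForm, Finsupp.linearCombination_apply, Finsupp.sum, Finsupp.sum, LinearMap.sum_apply,
    map_sum]
  refine Finset.sum_congr rfl fun p _ => ?_
  rw [LinearMap.smul_apply, MvPolynomial.smul_eval, monomialOp, Module.End.mul_apply,
    partialPow_polyShift, partialPow_monomial, mulOp, LinearMap.mulLeft_apply, map_mul,
    eval_polyShift, MvPolynomial.eval_monomial, MvPolynomial.eval_monomial,
    Finsupp.prod_fintype _ _ (by simp), Finsupp.prod_fintype _ _ (by simp)]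
  simp [Finset.prod_mul_distrib]

/-- The polynomials `∑ a_{αβ} z^α ∏ (N)_{β_i} / N^{β_i} (-v_i)^{β_i} (1 - z_i v_i / N)^{B - β_i}`,
where `(N)_k` is the falling factorial. Up to nonvanishing factors this is the value at `z` of
the image of `∏ (z_i + w_i)^N` at `w_i = -N / v_i`. They converge to the signed symbol. -/
noncomputable def symbolApprox {n : ℕ} (a : WeylCoeffs n) (B N : ℕ) :
    MvPolynomial (Fin n ⊕ Fin n) ℂ :=
  a.sum fun p c =>
    MvPolynomial.monomial (p.1.sumElim p.2)
      (c * (-1) ^ (∑ i, p.2 i) * ∏ i, ((N.descFactorial (p.2 i) : ℂ) / N ^ p.2 i)) *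
    ∏ i, (1 - MvPolynomial.monomial (Finsupp.single (.inl i) 1 + Finsupp.single (.inr i) 1)
      (1 / N : ℂ)) ^ (B - p.2 i)

theorem eval_symbolApprox {n : ℕ} (a : WeylCoeffs n) (B N : ℕ) (x : Fin n ⊕ Fin n → ℂ) :
    MvPolynomial.eval x (symbolApprox a B N) = a.sum fun p c =>
      c * ((∏ i, x (.inl i) ^ p.1 i) * ∏ i, ((N.descFactorial (p.2 i) : ℂ) / N ^ p.2 i *
        ((-x (.inr i)) ^ p.2 i * (1 - x (.inl i) * x (.inr i) / N) ^ (B - p.2 i)))) := by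
  have h : ∀ i, MvPolynomial.eval x (MvPolynomial.monomial
      (Finsupp.single (Sum.inl i) 1 + Finsupp.single (Sum.inr i) 1) (1 / N : ℂ)) =
      x (.inl i) * x (.inr i) / N := fun i => by
    rw [← one_mul (1 / N : ℂ), ← MvPolynomial.monomial_mul, map_mul, MvPolynomial.eval_monomial,
      MvPolynomial.eval_monomial]
    simp
    ring
  rw [symbolApprox, Finsupp.sum, Finsupp.sum, map_sum]
  refine Finset.sum_congr rfl fun p _ => ?_
  rw [map_mul, map_prod, MvPolynomial.eval_monomial, Finsupp.prod_fintype _ _ (by simp),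
    Fintype.prod_sum_type, ← Finset.prod_pow_eq_pow_sum]
  simp only [map_pow, map_sub, map_one, h, Finsupp.sumElim_inl, Finsupp.sumElim_inr,
    fun i => neg_pow (x (.inr i)) (p.2 i), Finset.prod_mul_distrib]
  ring

theorem exists_totalDegree_symbolApprox_le {n : ℕ} (a : WeylCoeffs n) (B : ℕ) :
    ∃ D, ∀ N, (symbolApprox a B N).totalDegree ≤ D := by
  refine ⟨∑ p ∈ a.support, ((p.1.sumElim p.2).degree + ∑ i, (B - p.2 i) * 2), fun N => ?_⟩
  refine MvPolynomial.totalDegree_finsetSum_le fun p hp => ?_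
  refine le_trans ?_ (Finset.single_le_sum
    (f := fun p : (Fin n →₀ ℕ) × (Fin n →₀ ℕ) =>
      (p.1.sumElim p.2).degree + ∑ i, (B - p.2 i) * 2) (fun _ _ => Nat.zero_le _) hp)
  refine (MvPolynomial.totalDegree_mul _ _).trans (add_le_add ?_ ?_)
  · exact MvPolynomial.totalDegree_monomial_le _ _
  · refine (MvPolynomial.totalDegree_finsetProd _ _).trans (Finset.sum_le_sum fun i _ => ?_)
    refine (MvPolynomial.totalDegree_pow _ _).trans (Nat.mul_le_mul_left _ ?_)
    refine (MvPolynomial.totalDegree_sub _ _).trans (max_le (by simp) ?_)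
    refine (MvPolynomial.totalDegree_monomial_le _ _).trans ?_
    change Finsupp.degree _ ≤ 2
    rw [map_add, Finsupp.degree_single, Finsupp.degree_single]

theorem tendsto_descFactorial_div_pow (k : ℕ) :
    Tendsto (fun N : ℕ => (N.descFactorial k : ℂ) / N ^ k) atTop (𝓝 1) := by
  have h := (isEquivalent_descFactorial k)
  rw [Asymptotics.isEquivalent_iff_tendsto_one] at h
  · have h1 := (Complex.continuous_ofReal.tendsto 1).comp h
    refine (h1.congr fun N => ?_).trans (by simp)
    simp
  · filter_upwards [eventually_gt_atTop 0] with N hN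
    positivity

theorem tendsto_eval_symbolApprox {n : ℕ} (a : WeylCoeffs n) (B : ℕ) (x : Fin n ⊕ Fin n → ℂ) :
    Tendsto (fun N => MvPolynomial.eval x (symbolApprox a B N)) atTop
      (𝓝 (MvPolynomial.eval x (signedSymbol a))) := by
  simp only [eval_symbolApprox, eval_signedSymbol]
  refine tendsto_finsetSum _ fun p _ => ?_
  refine Tendsto.const_mul _ (Tendsto.const_mul _ (tendsto_finsetProd _ fun i _ => ?_))
  have h1 : Tendsto (fun N : ℕ => 1 - x (.inl i) * x (.inr i) / (N : ℂ)) atTop (𝓝 1) := by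
    simpa using (tendsto_const_div_atTop_nhds_zero_nat (x (.inl i) * x (.inr i))).const_sub 1
  simpa using (tendsto_descFactorial_div_pow (p.2 i)).mul ((h1.pow (B - p.2 i)).const_mul
    ((-x (.inr i)) ^ p.2 i))

/-- At `w_i = -N / v_i` one has `(z_i + w_i) (-v_i / N) = 1 - z_i v_i / N`. -/
theorem eval_symbolApprox_mul {n : ℕ} {a : WeylCoeffs n} {B N : ℕ}
    (hB : ∀ p ∈ a.support, ∀ i, p.2 i ≤ B) (hBN : B ≤ N) (hN : N ≠ 0) {x : Fin n ⊕ Fin n → ℂ}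
    (hx : ∀ i, x (.inr i) ≠ 0) :
    (∏ i, (x (.inl i) + -N / x (.inr i)) ^ (N - B)) * MvPolynomial.eval x (symbolApprox a B N) =
      (∏ i, (-x (.inr i) / N) ^ B) * MvPolynomial.eval (fun i => x (.inl i))
        (normalForm n a (polyShift (fun i => -N / x (.inr i))
          (MvPolynomial.monomial (Finsupp.equivFunOnFinite.symm fun _ => N) 1))) := by
  have hNC : (N : ℂ) ≠ 0 := by exact_mod_cast hN
  rw [eval_symbolApprox, eval_normalForm_polyShift_monomial, Finsupp.mul_sum, Finsupp.mul_sum]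
  refine Finset.sum_congr rfl fun p hp => ?_
  have key : ∀ i, (x (.inl i) + -N / x (.inr i)) ^ (N - B) *
      ((N.descFactorial (p.2 i) : ℂ) / N ^ p.2 i *
        ((-x (.inr i)) ^ p.2 i * (1 - x (.inl i) * x (.inr i) / N) ^ (B - p.2 i))) =
      (-x (.inr i) / N) ^ B * ((N.descFactorial (p.2 i) : ℂ) *
        (x (.inl i) + -N / x (.inr i)) ^ (N - p.2 i)) := by
    intro i
    have hi := hB p hp i
    have h1 : 1 - x (.inl i) * x (.inr i) / N =
        (x (.inl i) + -N / x (.inr i)) * (-x (.inr i) / N) := by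
      have := hx i
      field_simp
      ring
    have h2 : N - p.2 i = (N - B) + (B - p.2 i) := by omega
    have h3 : (-x (.inr i) / N) ^ B =
        (-x (.inr i) / N) ^ p.2 i * (-x (.inr i) / N) ^ (B - p.2 i) := by
      rw [← pow_add]
      congr 1
      omega
    rw [h1, h2, h3, mul_pow, pow_add, div_pow _ _ (p.2 i)]
    ring
  have h := Finset.prod_congr (rfl : (Finset.univ : Finset (Fin n)) = _) fun i _ => key i
  rw [Finset.prod_mul_distrib, Finset.prod_mul_distrib (f := fun i => (-x (.inr i) / N) ^ B)] at h
  simp only [Finsupp.equivFunOnFinite_symm_apply_apply]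
  linear_combination (a p * ∏ i, x (.inl i) ^ p.1 i) * h

/-- Preservation of stability, or of real stability, forces the signed symbol to be stable. -/
theorem PreservesStability.upperStable_signedSymbol {n : ℕ} {a : WeylCoeffs n}
    (ha : PreservesStability a) (ha0 : a ≠ 0) : UpperStable (signedSymbol a) := by
  rcases isEmpty_or_nonempty (Fin n) with hn | ⟨⟨j⟩⟩
  -- Without variables the symbol is a nonzero constant.
  · intro x _ h
    refine signedSymbol_ne_zero ha0 (MvPolynomial.funext fun y => ?_)
    rw [Subsingleton.elim y x, h, map_zero]
  obtain ⟨q, hq, hmax⟩ := Finset.exists_max_image a.support (fun p => p.2.degree)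
    (Finsupp.support_nonempty_iff.2 ha0)
  set B := q.2.degree with hBdef
  have hB : ∀ p ∈ a.support, ∀ i, p.2 i ≤ B := fun p hp i =>
    (Finsupp.le_degree i p.2).trans (hmax p hp)
  obtain ⟨D, hD⟩ := exists_totalDegree_symbolApprox_le a B
  refine (UpperStable.of_tendsto hD ?_ (tendsto_eval_symbolApprox a B)).resolve_right
    (signedSymbol_ne_zero ha0)
  filter_upwards [eventually_ge_atTop (B + (2 * (B + 1) + 1))] with N hN x hx h0
  have hN0 : N ≠ 0 := by omega
  have hx0 : ∀ i, x (.inr i) ≠ 0 := fun i h => by simpa [h] using hx (.inr i)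
  have hw : ∀ i, 0 < (-(N : ℂ) / x (.inr i)).im := fun i => by
    have h1 : (-(N : ℂ) / x (.inr i)).im = N * (x (.inr i)).im / Complex.normSq (x (.inr i)) := by
      simp [Complex.div_im]
      ring
    rw [h1]
    have := hx (.inr i)
    have := Complex.normSq_pos.2 (hx0 i)
    have : (0 : ℝ) < N := by exact_mod_cast Nat.pos_of_ne_zero hN0
    positivity
  have hle : q.2 + Finsupp.single j (2 * (B + 1) + 1) ≤
      Finsupp.equivFunOnFinite.symm fun _ => N := fun i => by
    have h1 := hB q hq i
    have h2 : Finsupp.single j (2 * (B + 1) + 1) i ≤ 2 * (B + 1) + 1 := by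
      rw [Finsupp.single_apply]
      split_ifs <;> omega
    rw [Finsupp.add_apply, Finsupp.equivFunOnFinite_symm_apply_apply]
    omega
  obtain ⟨ρ, hρ⟩ := exists_add_of_le hle
  have h1 := ha.upperStable_normalForm_polyShift hmax ⟨q, hq, rfl⟩ j
    (fun p hp => Nat.lt_succ_of_le (hB p hp j)) hw ρ
  rw [← Nat.succ_eq_add_one] at hρ
  rw [← hρ] at h1
  have h2 := eval_symbolApprox_mul hB (by omega) hN0 hx0
  rw [h0, mul_zero] at h2
  refine mul_ne_zero (Finset.prod_ne_zero_iff.2 fun i _ => pow_ne_zero _ (div_ne_zero ?_ ?_))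
    (h1 _ fun i => hx _) h2.symm
  · exact neg_ne_zero.2 (hx0 i)
  · exact_mod_cast hN0

/-! ### Duality -/

theorem normalForm_weylEquiv_symm {n : ℕ} (T : weylAlgebra n) :
    normalForm n ((weylEquiv n).symm T) = T := by
  conv_rhs => rw [← (weylEquiv n).apply_symm_apply T]
  rfl

theorem mem_stabilityPreservers_iff {n : ℕ} (T : weylAlgebra n) :
    T ∈ stabilityPreservers n ↔ T ≠ 0 ∧ UpperStable (signedSymbol ((weylEquiv n).symm T)) := by
  refine and_congr_right fun hT => ⟨fun h => ?_, fun h f hf => ?_⟩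
  · refine PreservesStability.upperStable_signedSymbol (Or.inl ?_) (by simpa using hT)
    rwa [normalForm_weylEquiv_symm]
  · rw [← normalForm_weylEquiv_symm]
    exact h.normalForm hf

theorem mem_realStabilityPreservers_iff {n : ℕ} (T : weylAlgebra n) :
    T ∈ realStabilityPreservers n ↔
      T ∈ realWeyl n ∧ T ≠ 0 ∧ UpperStable (signedSymbol ((weylEquiv n).symm T)) := by
  refine and_congr_right fun hr => and_congr_right fun hT => ?_
  have hr' : ∀ p, ((weylEquiv n).symm T p).im = 0 := fun p => hr p.1 p.2
  refine ⟨fun h => ?_, fun h f hf => ?_⟩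
  · refine PreservesStability.upperStable_signedSymbol (Or.inr ⟨hr', ?_⟩) (by simpa using hT)
    rwa [normalForm_weylEquiv_symm]
  · have h1 := h.normalForm hf.1
    have hreal : conjPoly f = f := by
      ext m
      rw [conjPoly, MvPolynomial.coeff_map, Complex.conj_eq_iff_im.2 (hf.2 m)]
    have h2 := normalForm_conjPoly hr' f
    rw [hreal] at h2
    rw [normalForm_weylEquiv_symm] at h1 h2
    refine h1.imp (fun h3 => ⟨h3, fun m => ?_⟩) id
    rw [← Complex.conj_eq_iff_im, ← MvPolynomial.coeff_map]
    exact (congrArg (MvPolynomial.coeff m) h2).symm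

theorem weylEquiv_symm_weylAdjoint {n : ℕ} (T : weylAlgebra n) :
    (weylEquiv n).symm (weylAdjoint T) = adjointCoeffs ((weylEquiv n).symm T) := by
  rw [weylAdjoint, LinearEquiv.symm_apply_apply]

theorem weylAdjoint_weylAdjoint {n : ℕ} (T : weylAlgebra n) : weylAdjoint (weylAdjoint T) = T := by
  rw [weylAdjoint, weylEquiv_symm_weylAdjoint, adjointCoeffs_adjointCoeffs,
    LinearEquiv.apply_symm_apply]

theorem weylAdjoint_ne_zero {n : ℕ} {T : weylAlgebra n} (hT : T ≠ 0) : weylAdjoint T ≠ 0 := by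
  intro h
  refine hT ?_
  rw [← weylAdjoint_weylAdjoint T, h]
  simp [weylAdjoint, adjointCoeffs]

theorem weylAdjoint_mem_stabilityPreservers {n : ℕ} {T : weylAlgebra n}
    (hT : T ∈ stabilityPreservers n) : weylAdjoint T ∈ stabilityPreservers n := by
  rw [mem_stabilityPreservers_iff] at hT ⊢
  rw [weylEquiv_symm_weylAdjoint]
  exact ⟨weylAdjoint_ne_zero hT.1, hT.2.adjointCoeffs⟩

theorem weylAdjoint_mem_realStabilityPreservers {n : ℕ} {T : weylAlgebra n}
    (hT : T ∈ realStabilityPreservers n) : weylAdjoint T ∈ realStabilityPreservers n := by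
  rw [mem_realStabilityPreservers_iff] at hT ⊢
  rw [weylEquiv_symm_weylAdjoint]
  refine ⟨fun α β => ?_, weylAdjoint_ne_zero hT.2.1, hT.2.2.adjointCoeffs⟩
  rw [weylCoeff_weylAdjoint, Complex.conj_im, hT.1 β α, neg_zero]

theorem theorem1p9 (n : ℕ) (T : weylAlgebra n) :
    (T ∈ stabilityPreservers n ↔ weylAdjoint T ∈ stabilityPreservers n) ∧
    (T ∈ realWeyl n →
      (T ∈ realStabilityPreservers n ↔ weylAdjoint T ∈ realStabilityPreservers n)) := by
  refine ⟨⟨weylAdjoint_mem_stabilityPreservers, fun h => ?_⟩, fun _ =>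
    ⟨weylAdjoint_mem_realStabilityPreservers, fun h => ?_⟩⟩
  · simpa only [weylAdjoint_weylAdjoint] using weylAdjoint_mem_stabilityPreservers h
  · simpa only [weylAdjoint_weylAdjoint] using weylAdjoint_mem_realStabilityPreservers h
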